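/- Let $p$ be a prime, let $F/\mathbb{Q}$ be a finite Galois extension, and let $\mathbb{Q}^{\mathrm{ab}}$ be the maximal abelian extension of $\mathbb{Q}$, with $\Gamma = \mathrm{Gal}(\mathbb{Q}^{\mathrm{ab}}/\mathbb{Q})$ acting on $R := F \otimes_{\mathbb{Q}} \mathbb{Q}^{\mathrm{ab}}$ through the second factor. Equip $R$ with the supremum norm $|\cdot|$ over all places above $p$ (the multiplicative nonarchimedean seminorms on $R$ extending the normalized $p$-adic absolute value of $\mathbb{Q}$). Let $W_{p^n}(R)$ be the ring of $p$-typical Witt vectors with components $x_1, x_p, \dots, x_{p^n}$, and set $|x|_W = \sup_{0\le i \le n} |x_{p^i}|^{1/p^i}$ for $x\in W_{p^n}(R)$. Let $\underleftarrow{W}(R)$ be the inverse limit of the rings $W_{p^n}(R)$ ($n \ge 0$) along the Witt vector Frobenius maps $W_{p^{n+1}}(R) \to W_{p^n}(R)$, and let $\underleftarrow{W}^{\dagger}(R)$ be the subring of all $\underline{x} = (\underline{x}_{p^{-n}})_{n \ge 0}$, $\underline{x}_{p^{-n}} \in W_{p^n}(R)$, such that for some real $b > 0$ one has $p^{-bn}\,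 |\underline{x}_{p^{-n}}|_W^{p^n} \to 0$ as $n \to \infty$. Let $\varphi^{-1}$ be the map sending $\underline{x}$ to the system whose $n$-th term is the restriction of $\underline{x}_{p^{-n-1}}$ to $W_{p^n}(R)$, and let $\Gamma$ act by functoriality. Then, among the subfields of $F$ which are Galois over $\mathbb{Q}$ and in which $p$ splits completely, there is a largest one, $F_0$, and the ring of elements of $\underleftarrow{W}^{\dagger}(F \otimes_{\mathbb{Q}} \mathbb{Q}^{\mathrm{ab}})$ fixed by $\varphi^{-1}$ and by $\Gamma$ satisfies $$\left(\underleftarrow{W}^{\dagger}(F \otimes_{\mathbb{Q}} \mathbb{Q}^{\mathrm{ab}})\right)^{\varphi^{-1}, \Gamma} \cong \mathcal{O}_{F_0,(p)}$$ as rings, where $\mathcal{O}_{F_0,(p)}$ is the localization of the ring of integers $\mathcal{O}_{F_0}$ of $F_0$ at the multiplicative set of integers not divisible by $p$. -/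

import Mathlib

open scoped TensorProduct

set_option linter.unusedSectionVars false

namespace OverconvergentWitt

noncomputable section

/-! ### Finite-length Witt vectors

`TruncatedWittVector p (n + 1) R` is the ring of `p`-typical Witt vectors with components
indexed by `1, p, …, p ^ n`. -/

section Truncated

variable (p : ℕ) [Fact p.Prime] {R S : Type*} [CommRing R] [CommRing S]

theorem truncate_frobenius_eq_zero (n : ℕ) (x : WittVector p R)
    (hx : x ∈ RingHom.ker (WittVector.truncate (p := p) (R := R) (n + 1))) :
    x ∈ RingHom.ker ((WittVector.truncate (p := p) (R := R) n).comp WittVector.frobenius) := by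
  rw [WittVector.mem_ker_truncate] at hx
  have h1 : x = WittVector.verschiebung^[n + 1] (x.shift (n + 1)) :=
    WittVector.eq_iterate_verschiebung hx
  rw [RingHom.mem_ker, RingHom.comp_apply, ← RingHom.mem_ker, h1,
    Function.iterate_succ_apply', WittVector.frobenius_verschiebung]
  refine Ideal.mul_mem_right _ _ ?_
  rw [WittVector.mem_ker_truncate]
  intro i hi
  exact WittVector.iterate_verschiebung_coeff_eq_zero _ hi

/-- The Witt vector Frobenius on finite-length Witt vectors, shortening the length by one:
it is the map induced by `WittVector.frobenius`. -/
def truncFrobenius (n : ℕ) : TruncatedWittVector p (n + 1) R →+* TruncatedWittVector p n R :=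
  RingHom.liftOfSurjective (WittVector.truncate (p := p) (R := R) (n + 1))
    (WittVector.truncate_surjective p (n + 1) R)
    ⟨(WittVector.truncate (p := p) (R := R) n).comp WittVector.frobenius,
      truncate_frobenius_eq_zero p n⟩

theorem truncFrobenius_truncate (n : ℕ) (x : WittVector p R) :
    truncFrobenius p n (WittVector.truncate (n + 1) x) =
      WittVector.truncate n (WittVector.frobenius x) :=
  RingHom.liftOfRightInverse_comp_apply _ _ _ _ x

/-- Functoriality of finite-length Witt vectors. -/
def truncMap (n : ℕ) (f : R →+* S) : TruncatedWittVector p n R →+* TruncatedWittVector p n S :=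
  RingHom.liftOfSurjective (WittVector.truncate (p := p) (R := R) n)
    (WittVector.truncate_surjective p n R)
    ⟨(WittVector.truncate (p := p) (R := S) n).comp (WittVector.map f), by
      intro x hx
      rw [WittVector.mem_ker_truncate] at hx
      rw [RingHom.mem_ker, RingHom.comp_apply, ← RingHom.mem_ker, WittVector.mem_ker_truncate]
      intro i hi
      rw [WittVector.map_coeff, hx i hi, map_zero]⟩

theorem truncMap_truncate (n : ℕ) (f : R →+* S) (x : WittVector p R) :
    truncMap p n f (WittVector.truncate n x) = WittVector.truncate n (WittVector.map f x) :=
  RingHom.liftOfRightInverse_comp_apply _ _ _ _ x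

theorem truncMap_coeff (n : ℕ) (f : R →+* S) (x : TruncatedWittVector p n R) (i : Fin n) :
    (truncMap p n f x).coeff i = f (x.coeff i) := by
  obtain ⟨x, rfl⟩ := WittVector.truncate_surjective p n R x
  rw [truncMap_truncate, WittVector.coeff_truncate, WittVector.map_coeff,
    WittVector.coeff_truncate]

end Truncated

/-! ### The inverse limit along Frobenius -/

section InverseLimit

variable (p : ℕ) [Fact p.Prime] (R : Type*) [CommRing R] {S : Type*} [CommRing S]

/-- The inverse limit of the rings `W_{p ^ n}(R)` along the Frobenius maps
`F : W_{p ^ (n + 1)}(R) → W_{p ^ n}(R)`; the `n`-th entry of an element is its projection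
to `W_{p ^ n}(R)`. -/
def WArrow : Subring (∀ n : ℕ, TruncatedWittVector p (n + 1) R) where
  carrier := {x | ∀ n, truncFrobenius p (n + 1) (x (n + 1)) = x n}
  mul_mem' hx hy n := by simp only [Pi.mul_apply, map_mul, hx n, hy n]
  one_mem' n := by simp only [Pi.one_apply, map_one]
  add_mem' hx hy n := by simp only [Pi.add_apply, map_add, hx n, hy n]
  zero_mem' n := by simp only [Pi.zero_apply, map_zero]
  neg_mem' hx n := by simp only [Pi.neg_apply, map_neg, hx n]

variable {R}

theorem truncFrobenius_truncate_comm (n : ℕ) (x : TruncatedWittVector p (n + 2) R) :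
    truncFrobenius p n (TruncatedWittVector.truncate (Nat.le_succ (n + 1)) x) =
      TruncatedWittVector.truncate (Nat.le_succ n) (truncFrobenius p (n + 1) x) := by
  obtain ⟨x, rfl⟩ := WittVector.truncate_surjective p (n + 2) R x
  rw [TruncatedWittVector.truncate_wittVector_truncate, truncFrobenius_truncate,
    truncFrobenius_truncate, TruncatedWittVector.truncate_wittVector_truncate]

theorem truncFrobenius_truncMap (n : ℕ) (f : R →+* S) (x : TruncatedWittVector p (n + 1) R) :
    truncFrobenius p n (truncMap p (n + 1) f x) = truncMap p n f (truncFrobenius p n x) := by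
  obtain ⟨x, rfl⟩ := WittVector.truncate_surjective p (n + 1) R x
  rw [truncMap_truncate, truncFrobenius_truncate, truncFrobenius_truncate, truncMap_truncate]
  congr 1
  ext i
  simp only [WittVector.coeff_frobenius, WittVector.map_coeff, MvPolynomial.aeval_def,
    MvPolynomial.eval₂_eq, map_sum, map_mul, map_prod, map_pow]
  simp

/-- The inverse Frobenius `φ⁻¹` on the inverse limit: the `n`-th entry of the image is the
restriction of the `(n + 1)`-st entry from `W_{p ^ (n + 1)}(R)` to `W_{p ^ n}(R)`. -/
def phiInv : WArrow p R →+* WArrow p R where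
  toFun x := ⟨fun n => TruncatedWittVector.truncate (Nat.le_succ (n + 1)) (x.1 (n + 1)), fun n => by
    rw [truncFrobenius_truncate_comm, x.2 (n + 1)]⟩
  map_one' := by ext1; funext n; exact map_one _
  map_mul' x y := by ext1; funext n; exact map_mul _ _ _
  map_zero' := by ext1; funext n; exact map_zero _
  map_add' x y := by ext1; funext n; exact map_add _ _ _

/-- Functoriality of the inverse limit in the ring. -/
def WArrow.map (f : R →+* S) : WArrow p R →+* WArrow p S where
  toFun x := ⟨fun n => truncMap p (n + 1) f (x.1 n), fun n => by
    rw [truncFrobenius_truncMap, x.2 n]⟩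
  map_one' := by ext1; funext n; exact map_one _
  map_mul' x y := by ext1; funext n; exact map_mul _ _ _
  map_zero' := by ext1; funext n; exact map_zero _
  map_add' x y := by ext1; funext n; exact map_add _ _ _

end InverseLimit
/-! ### Norms on Witt vectors and the overconvergent subring -/

section Norms

variable (p : ℕ) [Fact p.Prime] {R : Type*} [CommRing R]

theorem teichmuller_mul_coeff (a : R) (x : WittVector p R) (n : ℕ) :
    (WittVector.teichmuller p a * x).coeff n = a ^ p ^ n * x.coeff n := by
  -- first for rings in which `p` is invertible, by ghost components
  have key₁ : ∀ (σ : Type _) (a : MvPolynomial σ ℚ) (x : WittVector p (MvPolynomial σ ℚ)) (n : ℕ),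
      (WittVector.teichmuller p a * x).coeff n = a ^ p ^ n * x.coeff n := by
    intro σ a x n
    have hinv : Invertible (p : MvPolynomial σ ℚ) := by
      have : (p : MvPolynomial σ ℚ) = MvPolynomial.C (p : ℚ) := by simp
      rw [this]
      have : Invertible (p : ℚ) :=
        invertibleOfNonzero (by exact_mod_cast (Fact.out : p.Prime).ne_zero)
      exact Invertible.map (MvPolynomial.C : ℚ →+* MvPolynomial σ ℚ) (p : ℚ)
    have h : WittVector.teichmuller p a * x
        = WittVector.mk p (fun n => a ^ p ^ n * x.coeff n) := by
      apply (WittVector.ghostMap.bijective_of_invertible p (MvPolynomial σ ℚ)).1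
      funext m
      rw [WittVector.ghostMap_apply, WittVector.ghostMap_apply, map_mul,
        WittVector.ghostComponent_teichmuller, WittVector.ghostComponent_apply,
        WittVector.ghostComponent_apply, wittPolynomial_eq_sum_C_mul_X_pow]
      simp only [map_sum, map_mul, MvPolynomial.aeval_C, map_pow, MvPolynomial.aeval_X,
        Finset.mul_sum]
      refine Finset.sum_congr rfl fun i hi => ?_
      have hmi : p ^ m = p ^ i * p ^ (m - i) := by
        rw [← pow_add, Nat.add_sub_cancel' (Nat.lt_succ_iff.1 (Finset.mem_range.1 hi))]
      change _ = _ * (a ^ p ^ i * x.coeff i) ^ p ^ (m - i)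
      rw [mul_pow, ← pow_mul, ← hmi]
      ring
    rw [h]
    rfl
  have key₂ : ∀ (σ : Type _) (a : MvPolynomial σ ℤ) (x : WittVector p (MvPolynomial σ ℤ)) (n : ℕ),
      (WittVector.teichmuller p a * x).coeff n = a ^ p ^ n * x.coeff n := by
    intro σ a x n
    have hinj : Function.Injective (MvPolynomial.map (σ := σ) (Int.castRingHom ℚ)) :=
      MvPolynomial.map_injective _ Int.cast_injective
    apply hinj
    rw [← WittVector.map_coeff, map_mul, WittVector.map_teichmuller, key₁, map_mul, map_pow,
      WittVector.map_coeff]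
  obtain ⟨a, rfl⟩ := MvPolynomial.counit_surjective R a
  obtain ⟨x, rfl⟩ := WittVector.map_surjective _ (MvPolynomial.counit_surjective R) x
  rw [← WittVector.map_teichmuller, ← map_mul, WittVector.map_coeff, key₂, map_mul, map_pow,
    WittVector.map_coeff]

/-- The ring of polynomials `∑ aₖ Tᵏ` with `|aₖ| ≤ Mᵏ` for all `k`. -/
def boundedPoly (v : RingSeminorm R) (hv : IsNonarchimedean v) (h1 : v 1 ≤ 1) (M : ℝ)
    (hM : 0 ≤ M) : Subring (Polynomial R) where
  carrier := {f | ∀ k, v (f.coeff k) ≤ M ^ k}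
  zero_mem' k := by simp only [Polynomial.coeff_zero, map_zero]; positivity
  one_mem' k := by
    rw [Polynomial.coeff_one]
    split_ifs with h
    · subst h; simpa using h1
    · rw [map_zero]; positivity
  add_mem' {f g} hf hg k := by
    rw [Polynomial.coeff_add]
    exact (hv _ _).trans (max_le (hf k) (hg k))
  neg_mem' {f} hf k := by
    rw [Polynomial.coeff_neg, map_neg_eq_map]; exact hf k
  mul_mem' {f g} hf hg k := by
    rw [Polynomial.coeff_mul]
    have hs : ∀ s : Finset (ℕ × ℕ), (∀ i ∈ s, v (f.coeff i.1 * g.coeff i.2) ≤ M ^ k) →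
        v (∑ i ∈ s, f.coeff i.1 * g.coeff i.2) ≤ M ^ k := by
      classical
      intro s
      induction s using Finset.induction_on with
      | empty => intro _; simp only [Finset.sum_empty, map_zero]; positivity
      | insert a s ha ih =>
        intro h
        rw [Finset.sum_insert ha]
        exact (hv _ _).trans (max_le (h a (Finset.mem_insert_self _ _))
          (ih fun i hi => h i (Finset.mem_insert_of_mem hi)))
    refine hs _ fun i hi => ?_
    rw [← Finset.HasAntidiagonal.mem_antidiagonal.1 hi, pow_add]
    exact (map_mul_le_mul _ _ _).trans
      (mul_le_mul (hf _) (hg _) (apply_nonneg _ _) (by positivity))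

theorem exists_boundedPoly_lift (v : RingSeminorm R) (hv : IsNonarchimedean v) (h1 : v 1 ≤ 1)
    (M : ℝ) (hM : 0 ≤ M) (x : WittVector p R) (hx : ∀ i, v (x.coeff i) ≤ M ^ p ^ i) :
    ∃ z : WittVector p (boundedPoly v hv h1 M hM),
      WittVector.map (boundedPoly v hv h1 M hM).subtype z =
        WittVector.teichmuller p Polynomial.X * WittVector.map Polynomial.C x := by
  refine ⟨WittVector.mk p fun i => ⟨Polynomial.X ^ p ^ i * Polynomial.C (x.coeff i), ?_⟩, ?_⟩
  · intro k
    rw [mul_comm, Polynomial.coeff_C_mul_X_pow]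
    split_ifs with h
    · subst h; exact hx i
    · rw [map_zero]; positivity
  · ext i : 1
    rw [WittVector.map_coeff, teichmuller_mul_coeff, WittVector.map_coeff]
    rfl

theorem coeff_add_le (v : RingSeminorm R) (hv : IsNonarchimedean v) (h1 : v 1 ≤ 1)
    (M : ℝ) (hM : 0 ≤ M) (x y : WittVector p R) (hx : ∀ i, v (x.coeff i) ≤ M ^ p ^ i)
    (hy : ∀ i, v (y.coeff i) ≤ M ^ p ^ i) (i : ℕ) : v ((x + y).coeff i) ≤ M ^ p ^ i := by
  obtain ⟨z, hz⟩ := exists_boundedPoly_lift p v hv h1 M hM x hx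
  obtain ⟨w, hw⟩ := exists_boundedPoly_lift p v hv h1 M hM y hy
  have h := congrArg (fun u => u.coeff i)
    (show WittVector.map (boundedPoly v hv h1 M hM).subtype (z + w) =
      WittVector.teichmuller p Polynomial.X * WittVector.map Polynomial.C (x + y) by
        rw [map_add, map_add, mul_add, hz, hw])
  simp only [WittVector.map_coeff, teichmuller_mul_coeff] at h
  have h2 := ((z + w).coeff i).2 (p ^ i)
  rw [Subring.subtype_apply] at h
  rw [h, mul_comm, Polynomial.coeff_C_mul_X_pow, if_pos rfl] at h2
  exact h2

theorem coeff_mul_le (v : RingSeminorm R) (hv : IsNonarchimedean v) (h1 : v 1 ≤ 1)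
    (M : ℝ) (hM : 0 ≤ M) (x y : WittVector p R) (hx : ∀ i, v (x.coeff i) ≤ M ^ p ^ i)
    (hy : ∀ i, v (y.coeff i) ≤ M ^ p ^ i) (i : ℕ) :
    v ((x * y).coeff i) ≤ (M ^ 2) ^ p ^ i := by
  obtain ⟨z, hz⟩ := exists_boundedPoly_lift p v hv h1 M hM x hx
  obtain ⟨w, hw⟩ := exists_boundedPoly_lift p v hv h1 M hM y hy
  have h := congrArg (fun u => u.coeff i)
    (show WittVector.map (boundedPoly v hv h1 M hM).subtype (z * w) =
      WittVector.teichmuller p (Polynomial.X * Polynomial.X) *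
        WittVector.map Polynomial.C (x * y) by
        rw [map_mul, map_mul, map_mul, hz, hw]; ring)
  simp only [WittVector.map_coeff, teichmuller_mul_coeff] at h
  have h2 := ((z * w).coeff i).2 (2 * p ^ i)
  rw [Subring.subtype_apply] at h
  rw [h, ← pow_two, ← pow_mul, mul_comm (Polynomial.X ^ _), Polynomial.coeff_C_mul_X_pow,
    if_pos rfl] at h2
  rw [← pow_mul]
  exact h2

theorem coeff_neg_le (v : RingSeminorm R) (hv : IsNonarchimedean v) (h1 : v 1 ≤ 1)
    (M : ℝ) (hM : 0 ≤ M) (x : WittVector p R) (hx : ∀ i, v (x.coeff i) ≤ M ^ p ^ i)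
    (i : ℕ) : v ((-x).coeff i) ≤ M ^ p ^ i := by
  obtain ⟨z, hz⟩ := exists_boundedPoly_lift p v hv h1 M hM x hx
  have h := congrArg (fun u => u.coeff i)
    (show WittVector.map (boundedPoly v hv h1 M hM).subtype (-z) =
      WittVector.teichmuller p Polynomial.X * WittVector.map Polynomial.C (-x) by
        rw [map_neg, map_neg, mul_neg, hz])
  simp only [WittVector.map_coeff, teichmuller_mul_coeff] at h
  have h2 := ((-z).coeff i).2 (p ^ i)
  rw [Subring.subtype_apply] at h
  rw [h, mul_comm, Polynomial.coeff_C_mul_X_pow, if_pos rfl] at h2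
  exact h2

/-- The function `|(x_{p ^ i})_i|_W = sup_i |x_{p ^ i}| ^ (1 / p ^ i)` on finite-length
Witt vectors. -/
def wittNorm (v : RingSeminorm R) {n : ℕ} (x : TruncatedWittVector p n R) : ℝ :=
  ⨆ i : Fin n, v (x.coeff i) ^ (1 / (p : ℝ) ^ (i : ℕ))

theorem wittNorm_nonneg (v : RingSeminorm R) {n : ℕ} (x : TruncatedWittVector p n R) :
    0 ≤ wittNorm p v x :=
  Real.iSup_nonneg fun _ => Real.rpow_nonneg (apply_nonneg _ _) _

theorem wittNorm_le_iff (v : RingSeminorm R) {n : ℕ} (x : TruncatedWittVector p n R)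
    {M : ℝ} (hM : 0 ≤ M) :
    wittNorm p v x ≤ M ↔ ∀ i : Fin n, v (x.coeff i) ≤ M ^ p ^ (i : ℕ) := by
  have hp : ∀ i : ℕ, (0 : ℝ) < (p : ℝ) ^ i := fun i =>
    pow_pos (by exact_mod_cast (Fact.out : p.Prime).pos) i
  have hi : ∀ i : Fin n, v (x.coeff i) ^ (1 / (p : ℝ) ^ (i : ℕ)) ≤ M ↔
      v (x.coeff i) ≤ M ^ p ^ (i : ℕ) := by
    intro i
    rw [one_div, Real.rpow_inv_le_iff_of_pos (apply_nonneg _ _) hM (hp _),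
      ← Nat.cast_pow, Real.rpow_natCast]
  constructor
  · intro h i
    rw [← hi]
    exact (le_ciSup (f := fun i : Fin n => v (x.coeff i) ^ (1 / (p : ℝ) ^ (i : ℕ)))
      (Set.finite_range _).bddAbove i).trans h
  · intro h
    exact Real.iSup_le (fun i => (hi i).2 (h i)) hM

theorem out_coeff_le (v : RingSeminorm R) {n : ℕ} (x : TruncatedWittVector p n R)
    {M : ℝ} (hM : 0 ≤ M) (h : wittNorm p v x ≤ M) (i : ℕ) :
    v (x.out.coeff i) ≤ M ^ p ^ i := by
  by_cases hi : i < n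
  · have := (wittNorm_le_iff p v x hM).1 h ⟨i, hi⟩
    rwa [← TruncatedWittVector.coeff_out] at this
  · have : x.out.coeff i = 0 := by
      simp [TruncatedWittVector.out, hi]
    rw [this, map_zero]
    positivity

theorem truncate_out {n : ℕ} (x : TruncatedWittVector p n R) :
    WittVector.truncate n x.out = x :=
  TruncatedWittVector.truncateFun_out x

theorem wittNorm_add_le (v : RingSeminorm R) (hv : IsNonarchimedean v) (h1 : v 1 ≤ 1) {n : ℕ}
    (x y : TruncatedWittVector p n R) {M : ℝ} (hM : 0 ≤ M) (hx : wittNorm p v x ≤ M)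
    (hy : wittNorm p v y ≤ M) : wittNorm p v (x + y) ≤ M := by
  rw [wittNorm_le_iff p v _ hM]
  intro i
  have h := coeff_add_le p v hv h1 M hM x.out y.out (out_coeff_le p v x hM hx)
    (out_coeff_le p v y hM hy) i
  rwa [← WittVector.coeff_truncate, map_add, truncate_out, truncate_out] at h

theorem wittNorm_mul_le (v : RingSeminorm R) (hv : IsNonarchimedean v) (h1 : v 1 ≤ 1) {n : ℕ}
    (x y : TruncatedWittVector p n R) {M : ℝ} (hM : 0 ≤ M) (hx : wittNorm p v x ≤ M)
    (hy : wittNorm p v y ≤ M) : wittNorm p v (x * y) ≤ M ^ 2 := by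
  rw [wittNorm_le_iff p v _ (by positivity)]
  intro i
  have h := coeff_mul_le p v hv h1 M hM x.out y.out (out_coeff_le p v x hM hx)
    (out_coeff_le p v y hM hy) i
  rwa [← WittVector.coeff_truncate, map_mul, truncate_out, truncate_out] at h

theorem wittNorm_neg_le (v : RingSeminorm R) (hv : IsNonarchimedean v) (h1 : v 1 ≤ 1) {n : ℕ}
    (x : TruncatedWittVector p n R) {M : ℝ} (hM : 0 ≤ M) (hx : wittNorm p v x ≤ M) :
    wittNorm p v (-x) ≤ M := by
  rw [wittNorm_le_iff p v _ hM]
  intro i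
  have h := coeff_neg_le p v hv h1 M hM x.out (out_coeff_le p v x hM hx) i
  rwa [← WittVector.coeff_truncate, map_neg, truncate_out] at h

theorem wittNorm_one_le (v : RingSeminorm R) (h1 : v 1 ≤ 1) (n : ℕ) :
    wittNorm p v (1 : TruncatedWittVector p n R) ≤ 1 := by
  rw [wittNorm_le_iff p v _ zero_le_one]
  intro i
  rw [one_pow, ← map_one (WittVector.truncate (p := p) (R := R) n), WittVector.coeff_truncate]
  rcases Nat.eq_zero_or_pos (i : ℕ) with hi | hi
  · rw [hi, WittVector.one_coeff_zero]; exact h1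
  · rw [WittVector.one_coeff_eq_of_pos _ _ _ hi, map_zero]; exact zero_le_one

/-- The `b`-overconvergence condition: `p ^ (-b n) * |x_{p ^ (-n)}|_W ^ (p ^ n) → 0`
as `n → ∞`. -/
def IsOverconvergentAt (v : RingSeminorm R) (b : ℝ) (x : WArrow p R) : Prop :=
  Filter.Tendsto (fun n : ℕ => (p : ℝ) ^ (-(b * n)) * wittNorm p v (x.1 n) ^ p ^ n)
    Filter.atTop (nhds 0)

theorem tendsto_rpow_neg {b : ℝ} (hb : 0 < b) :
    Filter.Tendsto (fun n : ℕ => (p : ℝ) ^ (-(b * n))) Filter.atTop (nhds 0) := by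
  have hp : (1 : ℝ) < p := by exact_mod_cast (Fact.out : p.Prime).one_lt
  have h : (fun n : ℕ => (p : ℝ) ^ (-(b * n))) = fun n : ℕ => ((p : ℝ) ^ (-b)) ^ n := by
    funext n
    rw [← Real.rpow_natCast, ← Real.rpow_mul (by positivity)]
    ring_nf
  rw [h]
  exact tendsto_pow_atTop_nhds_zero_of_lt_one (by positivity)
    (Real.rpow_lt_one_of_one_lt_of_neg hp (by linarith))

theorem IsOverconvergentAt.mono {v : RingSeminorm R} {b c : ℝ} {x : WArrow p R}
    (h : IsOverconvergentAt p v b x) (hbc : b ≤ c) : IsOverconvergentAt p v c x := by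
  have hp : (1 : ℝ) ≤ p := by exact_mod_cast (Fact.out : p.Prime).one_lt.le
  refine squeeze_zero (fun n => ?_) (fun n => ?_) h
  · have := wittNorm_nonneg p v (x.1 n); positivity
  · have := wittNorm_nonneg p v (x.1 n)
    refine mul_le_mul_of_nonneg_right ?_ (by positivity)
    refine Real.rpow_le_rpow_of_exponent_le hp ?_
    have : b * n ≤ c * n := mul_le_mul_of_nonneg_right hbc (Nat.cast_nonneg n)
    linarith

theorem IsOverconvergentAt.tendsto_max {v : RingSeminorm R} {b : ℝ} {x y : WArrow p R}
    (hx : IsOverconvergentAt p v b x) (hy : IsOverconvergentAt p v b y) :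
    Filter.Tendsto (fun n : ℕ => (p : ℝ) ^ (-(b * n)) *
      (max (wittNorm p v (x.1 n)) (wittNorm p v (y.1 n))) ^ p ^ n)
      Filter.atTop (nhds 0) := by
  have h := Filter.Tendsto.max hx hy
  rw [max_self] at h
  refine h.congr fun n => ?_
  rcases le_total (wittNorm p v (x.1 n)) (wittNorm p v (y.1 n)) with hle | hle
  · rw [max_eq_right hle, max_eq_right]
    exact mul_le_mul_of_nonneg_left (pow_le_pow_left₀ (wittNorm_nonneg p v _) hle _)
      (by positivity)
  · rw [max_eq_left hle, max_eq_left]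
    exact mul_le_mul_of_nonneg_left (pow_le_pow_left₀ (wittNorm_nonneg p v _) hle _)
      (by positivity)

theorem IsOverconvergentAt.add {v : RingSeminorm R} (hv : IsNonarchimedean v) (h1 : v 1 ≤ 1)
    {b : ℝ} {x y : WArrow p R}
    (hx : IsOverconvergentAt p v b x) (hy : IsOverconvergentAt p v b y) :
    IsOverconvergentAt p v b (x + y) := by
  refine squeeze_zero (fun n => ?_) (fun n => ?_) (IsOverconvergentAt.tendsto_max p hx hy)
  · have := wittNorm_nonneg p v ((x + y).1 n); positivity
  · refine mul_le_mul_of_nonneg_left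
      (pow_le_pow_left₀ (wittNorm_nonneg p v _) ?_ _) (by positivity)
    exact wittNorm_add_le p v hv h1 _ _
      (le_max_of_le_left (wittNorm_nonneg p v _)) (le_max_left _ _) (le_max_right _ _)

theorem IsOverconvergentAt.mul {v : RingSeminorm R} (hv : IsNonarchimedean v) (h1 : v 1 ≤ 1)
    {b : ℝ} {x y : WArrow p R}
    (hx : IsOverconvergentAt p v b x) (hy : IsOverconvergentAt p v b y) :
    IsOverconvergentAt p v (2 * b) (x * y) := by
  have hp : (0 : ℝ) < p := by exact_mod_cast (Fact.out : p.Prime).pos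
  have h := (IsOverconvergentAt.tendsto_max p hx hy).pow 2
  rw [zero_pow two_ne_zero] at h
  refine squeeze_zero (fun n => ?_) (fun n => ?_) h
  · have := wittNorm_nonneg p v ((x * y).1 n); positivity
  · rw [mul_pow, ← pow_mul, mul_comm (p ^ n) 2, pow_mul, pow_two ((p : ℝ) ^ _),
      ← Real.rpow_add hp, show -(b * (n : ℝ)) + -(b * n) = -(2 * b * n) by ring]
    refine mul_le_mul_of_nonneg_left
      (pow_le_pow_left₀ (wittNorm_nonneg p v _) ?_ _) (by positivity)
    exact wittNorm_mul_le p v hv h1 _ _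
      (le_max_of_le_left (wittNorm_nonneg p v _)) (le_max_left _ _) (le_max_right _ _)

theorem IsOverconvergentAt.neg {v : RingSeminorm R} (hv : IsNonarchimedean v) (h1 : v 1 ≤ 1)
    {b : ℝ} {x : WArrow p R} (hx : IsOverconvergentAt p v b x) :
    IsOverconvergentAt p v b (-x) := by
  refine squeeze_zero (fun n => ?_) (fun n => ?_) hx
  · have := wittNorm_nonneg p v ((-x).1 n); positivity
  · exact mul_le_mul_of_nonneg_left (pow_le_pow_left₀ (wittNorm_nonneg p v _)
      (wittNorm_neg_le p v hv h1 _ (wittNorm_nonneg p v _) le_rfl) _) (by positivity)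

theorem isOverconvergentAt_one {v : RingSeminorm R} (h1 : v 1 ≤ 1) {b : ℝ} (hb : 0 < b) :
    IsOverconvergentAt p v b (1 : WArrow p R) := by
  refine squeeze_zero (fun n => ?_) (fun n => ?_) (tendsto_rpow_neg p hb)
  · have := wittNorm_nonneg p v ((1 : WArrow p R).1 n); positivity
  · exact mul_le_of_le_one_right (by positivity)
      (pow_le_one₀ (wittNorm_nonneg p v _) (wittNorm_one_le p v h1 _))

/-- The ring of overconvergent Witt vectors: the union over `b > 0` of the sets of
`b`-overconvergent elements of the inverse limit. -/
def overconvergent (v : RingSeminorm R) (hv : IsNonarchimedean v) (h1 : v 1 ≤ 1) :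
    Subring (WArrow p R) where
  carrier := {x | ∃ b : ℝ, 0 < b ∧ IsOverconvergentAt p v b x}
  one_mem' := ⟨1, one_pos, isOverconvergentAt_one p h1 one_pos⟩
  mul_mem' := by
    rintro x y ⟨b, hb, hx⟩ ⟨c, hc, hy⟩
    exact ⟨2 * max b c, by positivity, IsOverconvergentAt.mul p hv h1
      (IsOverconvergentAt.mono p hx (le_max_left b c))
      (IsOverconvergentAt.mono p hy (le_max_right b c))⟩
  add_mem' := by
    rintro x y ⟨b, hb, hx⟩ ⟨c, hc, hy⟩
    exact ⟨max b c, by positivity, IsOverconvergentAt.add p hv h1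
      (IsOverconvergentAt.mono p hx (le_max_left b c))
      (IsOverconvergentAt.mono p hy (le_max_right b c))⟩
  zero_mem' := by
    have h := IsOverconvergentAt.add p hv h1 (isOverconvergentAt_one (R := R) p h1 one_pos)
      (IsOverconvergentAt.neg p hv h1 (isOverconvergentAt_one p h1 one_pos))
    rw [add_neg_cancel] at h
    exact ⟨1, one_pos, h⟩
  neg_mem' := by
    rintro x ⟨b, hb, hx⟩
    exact ⟨b, hb, IsOverconvergentAt.neg p hv h1 hx⟩

end Norms

/-! ### The supremum norm over the places above `p` -/

section Places

variable (p : ℕ) [Fact p.Prime] (R : Type*) [CommRing R] [Algebra ℚ R]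

/-- The places of a `ℚ`-algebra above `p`: the multiplicative nonarchimedean seminorms on it
which extend the normalised `p`-adic absolute value of `ℚ`. (On a field these are absolute
values; on a finite product of fields these are the places of the factors.) -/
def Place : Type _ :=
  {v : MulRingSeminorm R // IsNonarchimedean v ∧ ∀ q : ℚ, v (algebraMap ℚ R q) = padicNorm p q}

variable {R}

theorem place_bddAbove [Algebra.IsIntegral ℚ R] (x : R) :
    BddAbove (Set.range fun v : Place p R => v.1 x) := by
  obtain ⟨f, hf, hfx⟩ := Algebra.IsIntegral.isIntegral (R := ℚ) x
  set C : ℝ := ∑ i ∈ Finset.range f.natDegree, (padicNorm p (f.coeff i) : ℝ) with hC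
  have hC0 : 0 ≤ C := Finset.sum_nonneg fun i _ => by exact_mod_cast padicNorm.nonneg _
  refine ⟨max 1 C, ?_⟩
  rintro _ ⟨v, rfl⟩
  rcases le_total (v.1 x) 1 with h | h
  · exact h.trans (le_max_left _ _)
  refine le_trans ?_ (le_max_right _ _)
  have hx : x ^ f.natDegree =
      -∑ i ∈ Finset.range f.natDegree, algebraMap ℚ R (f.coeff i) * x ^ i := by
    rw [Polynomial.eval₂_eq_sum_range, Finset.sum_range_succ, hf.coeff_natDegree, map_one,
      one_mul] at hfx
    exact eq_neg_of_add_eq_zero_right hfx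
  have hsum : ∀ (s : Finset ℕ) (g : ℕ → R), v.1 (∑ i ∈ s, g i) ≤ ∑ i ∈ s, v.1 (g i) := by
    intro s g
    induction s using Finset.induction_on with
    | empty => simp
    | insert a s ha ih =>
      rw [Finset.sum_insert ha, Finset.sum_insert ha]
      exact (map_add_le_add _ _ _).trans (by gcongr)
  have hd : f.natDegree ≠ 0 := by
    intro hd
    have h1 : (1 : R) = 0 := by
      rw [hd] at hx; simpa using hx
    have : v.1 1 = 0 := by rw [h1, map_zero]
    rw [map_one] at this
    exact one_ne_zero this
  obtain ⟨d, hd⟩ := Nat.exists_eq_succ_of_ne_zero hd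
  have hle : v.1 x ^ f.natDegree ≤ C * v.1 x ^ d := by
    rw [← map_pow, hx, map_neg_eq_map]
    refine (hsum _ _).trans ?_
    rw [hC, Finset.sum_mul]
    refine Finset.sum_le_sum fun i hi => ?_
    rw [map_mul, map_pow, v.2.2]
    refine mul_le_mul_of_nonneg_left (pow_le_pow_right₀ h ?_)
      (by exact_mod_cast padicNorm.nonneg _)
    have := Finset.mem_range.1 hi
    omega
  have hpos : 0 < v.1 x ^ d := pow_pos (by linarith) d
  rw [hd, pow_succ, mul_comm] at hle
  exact le_of_mul_le_mul_right hle hpos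

variable (R)

/-- The supremum seminorm `|x| = sup_v v x` over all places `v` above `p`, on an algebraic
`ℚ`-algebra. -/
def supSeminorm [Algebra.IsIntegral ℚ R] : RingSeminorm R where
  toFun x := ⨆ v : Place p R, v.1 x
  map_zero' := by simp
  add_le' x y := by
    refine Real.iSup_le (fun v => ?_) (add_nonneg (Real.iSup_nonneg fun v => apply_nonneg _ _)
      (Real.iSup_nonneg fun v => apply_nonneg _ _))
    exact (map_add_le_add _ _ _).trans (add_le_add (le_ciSup (place_bddAbove p x) v)
      (le_ciSup (place_bddAbove p y) v))
  neg' x := by simp only [map_neg_eq_map]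
  mul_le' x y := by
    have h0 : ∀ x : R, 0 ≤ ⨆ v : Place p R, v.1 x := fun x =>
      Real.iSup_nonneg fun v => apply_nonneg _ _
    refine Real.iSup_le (fun v => ?_) (mul_nonneg (h0 x) (h0 y))
    rw [map_mul]
    exact mul_le_mul (le_ciSup (place_bddAbove p x) v) (le_ciSup (place_bddAbove p y) v)
      (apply_nonneg _ _) (h0 x)

variable [Algebra.IsIntegral ℚ R]

theorem supSeminorm_apply (x : R) : supSeminorm p R x = ⨆ v : Place p R, v.1 x := rfl

theorem supSeminorm_isNonarchimedean : IsNonarchimedean (supSeminorm p R) := by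
  intro x y
  refine Real.iSup_le (fun v => ?_) (le_max_of_le_left (apply_nonneg _ _))
  exact (v.2.1 x y).trans (max_le_max (le_ciSup (place_bddAbove p x) v)
    (le_ciSup (place_bddAbove p y) v))

theorem supSeminorm_one_le : supSeminorm p R 1 ≤ 1 :=
  Real.iSup_le (fun v => (map_one v.1).le) zero_le_one

/-- The ring of overconvergent Witt vectors of an algebraic `ℚ`-algebra, with respect to the
supremum norm over the places above `p`. -/
def WDagger : Subring (WArrow p R) :=
  overconvergent p (supSeminorm p R) (supSeminorm_isNonarchimedean p R) (supSeminorm_one_le p R)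

end Places

/-! ### The base ring `F ⊗ ℚᵃᵇ` and its `(φ⁻¹, Γ)`-invariants -/

/-- The maximal abelian extension of a field `K` (in a fixed algebraic closure): the compositum
of all abelian extensions of `K`. -/
def maxAbelianExtension (K : Type*) [Field K] : IntermediateField K (AlgebraicClosure K) :=
  sSup {E : IntermediateField K (AlgebraicClosure K) | IsAbelianGalois K E}

/-- The maximal abelian extension `ℚᵃᵇ` of `ℚ`. -/
def Qab : Type := maxAbelianExtension ℚ

instance : Field Qab := inferInstanceAs (Field (maxAbelianExtension ℚ))

instance : CharZero Qab := inferInstanceAs (CharZero (maxAbelianExtension ℚ))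

theorem isIntegral_maxAbelianExtension (K : Type*) [Field K] :
    Algebra.IsIntegral K (maxAbelianExtension K) := inferInstance

instance : Algebra.IsIntegral ℚ Qab := by
  have h := isIntegral_maxAbelianExtension ℚ
  have e : (DivisionRing.toRatAlgebra : Algebra ℚ (maxAbelianExtension ℚ)) =
      (maxAbelianExtension ℚ).algebra' := Subsingleton.elim _ _
  change @Algebra.IsIntegral ℚ (maxAbelianExtension ℚ) _ _ DivisionRing.toRatAlgebra
  rw [e]
  exact h

section Invariants

variable (p : ℕ) [Fact p.Prime] (F : Type*) [Field F] [NumberField F]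

instance : Algebra.IsIntegral ℚ (F ⊗[ℚ] Qab) :=
  have : Algebra.IsIntegral F (F ⊗[ℚ] Qab) := inferInstance
  Algebra.IsIntegral.trans F

/-- The action of `Γ = Gal(ℚᵃᵇ/ℚ)` on `F ⊗ ℚᵃᵇ` through the second factor. -/
def gammaAct (σ : Gal(Qab/ℚ)) : F ⊗[ℚ] Qab →+* F ⊗[ℚ] Qab :=
  (Algebra.TensorProduct.map (AlgHom.id ℚ F) (σ : Qab →ₐ[ℚ] Qab)).toRingHom

/-- The ring of `(φ⁻¹, Γ)`-invariants of the ring of overconvergent Witt vectors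
of `F ⊗ ℚᵃᵇ`. -/
def invariants : Subring (WArrow p (F ⊗[ℚ] Qab)) where
  carrier := {x | x ∈ WDagger p (F ⊗[ℚ] Qab) ∧ phiInv p x = x ∧
    ∀ σ : Gal(Qab/ℚ), WArrow.map p (gammaAct F σ) x = x}
  one_mem' := ⟨one_mem _, map_one _, fun _ => map_one _⟩
  zero_mem' := ⟨zero_mem _, map_zero _, fun _ => map_zero _⟩
  mul_mem' hx hy := ⟨mul_mem hx.1 hy.1, by rw [map_mul, hx.2.1, hy.2.1],
    fun σ => by rw [map_mul, hx.2.2 σ, hy.2.2 σ]⟩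
  add_mem' hx hy := ⟨add_mem hx.1 hy.1, by rw [map_add, hx.2.1, hy.2.1],
    fun σ => by rw [map_add, hx.2.2 σ, hy.2.2 σ]⟩
  neg_mem' hx := ⟨neg_mem hx.1, by rw [map_neg, hx.2.1],
    fun σ => by rw [map_neg, hx.2.2 σ]⟩

end Invariants

/-! ### Number fields in which `p` splits completely, and localisation at `p` -/

/-- `p` splits completely in the number field `E`: every prime of `E` above `p` has
ramification index and residue degree one. -/
def SplitsCompletely (p : ℕ) (E : Type*) [Field E] [NumberField E] : Prop :=
  ∀ P ∈ (Ideal.span {(p : ℤ)}).primesOver (NumberField.RingOfIntegers E),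
    P.ramificationIdx ℤ = 1 ∧ P.inertiaDeg ℤ = 1

/-- The multiplicative set of (images of) the integers not divisible by the prime `p`. -/
def primeToP (p : ℕ) [hp : Fact p.Prime] (A : Type*) [CommRing A] : Submonoid A where
  carrier := {a | ∃ m : ℤ, ¬ (p : ℤ) ∣ m ∧ (m : A) = a}
  one_mem' := ⟨1, (Nat.prime_iff_prime_int.1 hp.out).not_dvd_one, Int.cast_one⟩
  mul_mem' := by
    rintro _ _ ⟨m, hm, rfl⟩ ⟨n, hn, rfl⟩
    exact ⟨m * n, fun h => ((Nat.prime_iff_prime_int.1 hp.out).dvd_or_dvd h).elim hm hn,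
      Int.cast_mul m n⟩

end

end OverconvergentWitt

/-!
Over a `ℚ`-algebra `R` the ghost map identifies Witt vectors with sequences. The ghost components
of a compatible system along Frobenius form one sequence, which `φ⁻¹` shifts; so the
`φ⁻¹`-invariants of the inverse limit are the systems `constWArrow p R r` of truncations of the
Witt vector `constWitt p R r` whose ghost components are all equal to some `r`
(`exists_eq_constWArrow`). Invariance under `Γ` then means that `r` lies in `F`
(`exists_eq_tmul_one_of_gammaAct_eq`).

Overconvergence of such a system says that all components of `constWitt p R r` are integral at all
places above `p`, because a component of norm greater than one contributes doubly exponential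
growth (`isOverconvergentAt_constWArrow_iff`). At a single place `v`, all components are integral
if and only if `r` is a `v`-adic limit of rational integers
(`Place.constWitt_mem_wittIntegers_iff`). Indeed, integrality of the component after `r` gives
`r ^ p ≡ r` modulo `p`, so that `r = m + p * s` with `m` a rational integer and `s` integral, and
the identity `constWitt (p * s) = V (constWitt s) + [s] * (p - V 1)` shows that `s` inherits the
property of `r`.

It remains to see that the `r` in `F` which are limits of rational integers at all places above `p`
are the elements of the localization at `p` of the ring of integers of `F₀`. Here `F₀` is the field
`splitSubfield p F` of elements all of whose `p`-adic conjugates lie in `ℚ_p`. It is stable under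
the Galois group. The prime `p` splits completely in a Galois number field if the integers of the
field are limits of rational integers at one place (`splitsCompletely_of_isLimitOfInt`), and in that
case they are so at every place (`SplitsCompletely.isLimitOfInt`); hence `F₀` is the largest
Galois subfield in which `p` splits completely. Finally, an element which is integral at all places
above `p` has a minimal polynomial whose coefficients have denominators prime to `p`, hence is an
algebraic integer divided by an integer prime to `p` (`exists_isIntegral_intCast_mul`).
-/

namespace OverconvergentWitt

/-! ### Witt vectors with constant ghost components -/

section ConstantGhost

variable (p : ℕ) [Fact p.Prime] {R : Type*} [CommRing R] [Algebra ℚ R]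

theorem bijective_ghostMap_of_algebraRat :
    Function.Bijective (WittVector.ghostMap : WittVector p R → ℕ → R) := by
  have hinv : Invertible ((p : ℚ) : ℚ) :=
    invertibleOfNonzero (by exact_mod_cast (Fact.out : p.Prime).ne_zero)
  have : Invertible (p : R) :=
    (Invertible.map (algebraMap ℚ R) (p : ℚ)).copy _ (map_natCast _ _).symm
  exact WittVector.ghostMap.bijective_of_invertible p R

variable {p} in
theorem ghostComponent_ext {x y : WittVector p R}
    (h : ∀ n, WittVector.ghostComponent n x = WittVector.ghostComponent n y) : x = y :=
  (bijective_ghostMap_of_algebraRat p).1 (funext h)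

variable (R) in
/-- The ring homomorphism sending an element `r` of a `ℚ`-algebra to the Witt vector all of whose
ghost components are equal to `r`. -/
noncomputable def constWitt : R →+* WittVector p R :=
  (RingEquiv.ofBijective (WittVector.ghostMap (p := p) (R := R))
    (bijective_ghostMap_of_algebraRat p)).symm.toRingHom.comp (Pi.constRingHom ℕ R)

@[simp]
theorem ghostComponent_constWitt (r : R) (n : ℕ) :
    WittVector.ghostComponent n (constWitt p R r) = r :=
  congrFun ((RingEquiv.ofBijective (WittVector.ghostMap (p := p) (R := R))
    (bijective_ghostMap_of_algebraRat p)).apply_symm_apply (Pi.constRingHom ℕ R r)) n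

theorem ghostComponent_zero_eq_coeff (x : WittVector p R) :
    WittVector.ghostComponent 0 x = x.coeff 0 := by
  simp [WittVector.ghostComponent_apply]

@[simp]
theorem constWitt_coeff_zero (r : R) : (constWitt p R r).coeff 0 = r := by
  rw [← ghostComponent_zero_eq_coeff, ghostComponent_constWitt]

theorem constWitt_coeff_one (r : R) : r ^ p + p * (constWitt p R r).coeff 1 = r := by
  have h := ghostComponent_constWitt p r 1
  rw [WittVector.ghostComponent_apply, wittPolynomial_one] at h
  simpa [add_comm] using h

theorem frobenius_constWitt (r : R) :
    WittVector.frobenius (constWitt p R r) = constWitt p R r :=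
  ghostComponent_ext fun n => by
    rw [WittVector.ghostComponent_frobenius, ghostComponent_constWitt, ghostComponent_constWitt]

/-- Over a `ℚ`-algebra, the Frobenius-fixed Witt vectors are those with constant ghost
components. -/
theorem eq_constWitt_of_frobenius_eq {x : WittVector p R} (hx : WittVector.frobenius x = x) :
    x = constWitt p R (x.coeff 0) := by
  refine ghostComponent_ext fun n => ?_
  rw [ghostComponent_constWitt]
  induction n with
  | zero => exact ghostComponent_zero_eq_coeff p x
  | succ n ih => rw [← WittVector.ghostComponent_frobenius, hx, ih]

theorem map_constWitt {S : Type*} [CommRing S] [Algebra ℚ S] (f : R →+* S) (r : R) :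
    WittVector.map f (constWitt p R r) = constWitt p S (f r) := by
  refine (eq_constWitt_of_frobenius_eq p ?_).trans ?_
  · conv_rhs => rw [← frobenius_constWitt]
    ext i
    simp only [WittVector.coeff_frobenius, WittVector.map_coeff, MvPolynomial.aeval_def,
      MvPolynomial.eval₂_eq, map_sum, map_mul, map_prod, map_pow]
    simp
  · rw [WittVector.map_coeff, constWitt_coeff_zero]

/-- The Witt vector `p - V 1` has ghost components `(p, 0, 0, …)`, so that its multiple by the
Teichmüller lift of `s` accounts for the initial ghost component which `V` kills. -/
theorem constWitt_p_mul (s : R) :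
    constWitt p R (p * s) = WittVector.verschiebung (constWitt p R s) +
      WittVector.teichmuller p s * ((p : WittVector p R) - WittVector.verschiebung 1) := by
  refine ghostComponent_ext fun n => ?_
  rw [ghostComponent_constWitt, map_add, map_mul, map_sub, map_natCast,
    WittVector.ghostComponent_teichmuller]
  cases n with
  | zero => simp [WittVector.ghostComponent_zero_verschiebung]; ring
  | succ n => simp [WittVector.ghostComponent_verschiebung]

end ConstantGhost

/-! ### Integrality of the components at a place -/

section Integrality

variable {p : ℕ} [Fact p.Prime] {R : Type*} [CommRing R] [Algebra ℚ R]

theorem Place.apply_intCast (v : Place p R) (m : ℤ) : v.1 (m : R) = padicNorm p m := by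
  rw [← map_intCast (algebraMap ℚ R), v.2.2]

theorem Place.apply_p (v : Place p R) : v.1 (p : R) = (p : ℝ)⁻¹ := by
  rw [← map_natCast (algebraMap ℚ R), v.2.2, padicNorm.padicNorm_p_of_prime]
  simp

theorem Place.apply_intCast_le_one (v : Place p R) (m : ℤ) : v.1 (m : R) ≤ 1 := by
  rw [v.apply_intCast]
  exact_mod_cast padicNorm.of_int m

theorem Place.apply_sub_le (v : Place p R) (x y : R) : v.1 (x - y) ≤ max (v.1 x) (v.1 y) := by
  rw [sub_eq_add_neg, ← map_neg_eq_map v.1 y]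
  exact v.2.1 _ _

theorem Place.exists_eq_p_pow_mul (v : Place p R) {x : R} {n : ℕ} (hx : v.1 x ≤ (p : ℝ)⁻¹ ^ n) :
    ∃ s : R, x = p ^ n * s ∧ v.1 s ≤ 1 := by
  have hp0 : (p : ℚ) ≠ 0 := by exact_mod_cast (Fact.out : p.Prime).ne_zero
  have hp : (0 : ℝ) < p := by exact_mod_cast (Fact.out : p.Prime).pos
  have h : x = p ^ n * (algebraMap ℚ R ((p : ℚ) ^ n)⁻¹ * x) := by
    rw [← mul_assoc, ← map_natCast (algebraMap ℚ R), ← map_pow, ← map_mul,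
      mul_inv_cancel₀ (pow_ne_zero _ hp0), map_one, one_mul]
  refine ⟨_, h, ?_⟩
  rw [h, map_mul, map_pow, v.apply_p] at hx
  exact le_of_mul_le_mul_left (by rwa [mul_one]) (by positivity)

/-- The ring of elements which are integral at a place. -/
def Place.integers (v : Place p R) : Subring R where
  carrier := {x | v.1 x ≤ 1}
  one_mem' := (map_one v.1).le
  zero_mem' := by simp
  mul_mem' {x y} hx hy := by
    change v.1 (x * y) ≤ 1
    rw [map_mul]
    exact mul_le_one₀ hx (apply_nonneg _ _) hy
  add_mem' {x y} hx hy := (v.2.1 x y).trans (max_le hx hy)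
  neg_mem' {x} hx := (map_neg_eq_map v.1 x).trans_le hx

theorem Place.mem_integers (v : Place p R) {x : R} : x ∈ v.integers ↔ v.1 x ≤ 1 := Iff.rfl

theorem Place.intCast_mem_integers (v : Place p R) (m : ℤ) : (m : R) ∈ v.integers :=
  v.apply_intCast_le_one m

/-- The Witt vectors whose components are integral at a place. -/
noncomputable def Place.wittIntegers (v : Place p R) : Subring (WittVector p R) :=
  (WittVector.map (p := p) v.integers.subtype).range

theorem Place.mem_wittIntegers (v : Place p R) {x : WittVector p R} :
    x ∈ v.wittIntegers ↔ ∀ i, v.1 (x.coeff i) ≤ 1 := by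
  constructor
  · rintro ⟨y, rfl⟩ i
    rw [WittVector.map_coeff]
    exact (y.coeff i).2
  · intro h
    exact ⟨WittVector.mk p fun i => ⟨x.coeff i, h i⟩, by ext i; simp⟩

theorem Place.verschiebung_mem_wittIntegers (v : Place p R) {x : WittVector p R} :
    WittVector.verschiebung x ∈ v.wittIntegers ↔ x ∈ v.wittIntegers := by
  rw [v.mem_wittIntegers, v.mem_wittIntegers]
  constructor
  · intro h i
    have := h (i + 1)
    rwa [WittVector.verschiebung_coeff_add_one] at this
  · rintro h (_ | i)
    · simp
    · rw [WittVector.verschiebung_coeff_add_one]; exact h i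

theorem Place.teichmuller_mul_mem_wittIntegers (v : Place p R) {s : R} (hs : v.1 s ≤ 1) :
    WittVector.teichmuller p s * ((p : WittVector p R) - WittVector.verschiebung 1) ∈
      v.wittIntegers := by
  refine mul_mem (v.mem_wittIntegers.2 fun i => ?_) (sub_mem (natCast_mem _ _)
    (v.verschiebung_mem_wittIntegers.2 (one_mem _)))
  rcases Nat.eq_zero_or_pos i with rfl | hi
  · simpa using hs
  · rw [WittVector.teichmuller_coeff_pos p s i hi, map_zero]; exact zero_le_one

/-- Division by `p` preserves integrality of all components, as long as the quotient is itself
integral. -/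
theorem Place.constWitt_p_mul_mem_iff (v : Place p R) {s : R} (hs : v.1 s ≤ 1) :
    constWitt p R (p * s) ∈ v.wittIntegers ↔ constWitt p R s ∈ v.wittIntegers := by
  rw [constWitt_p_mul, add_mem_cancel_right (v.teichmuller_mul_mem_wittIntegers hs),
    v.verschiebung_mem_wittIntegers]

/-- An element is a limit of integers at a place if for all `n` it differs from some rational
integer by an element of norm at most `p ^ (-n)`. Over a field this says that its image in the completion lies in `ℤ_p`. -/
def Place.IsLimitOfInt (v : Place p R) (r : R) : Prop :=
  ∀ n : ℕ, ∃ m : ℤ, v.1 (r - m) ≤ (p : ℝ)⁻¹ ^ n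

variable (p) in
open Polynomial in
/-- The polynomial `X ^ p - X` is congruent to the product of all `X - a` modulo `p`. -/
theorem p_dvd_X_pow_sub_X_sub_prod : C (p : ℤ) ∣
    (X ^ p - X : ℤ[X]) - ∏ a : ZMod p, (X - C (a.val : ℤ)) := by
  have hp : 1 < p := (Fact.out : p.Prime).one_lt
  have h : (X ^ p - X : (ZMod p)[X]) = ∏ a : ZMod p, (X - C a) := by
    have h1 := FiniteField.roots_X_pow_card_sub_X (ZMod p)
    rw [ZMod.card] at h1
    have h2 := prod_multiset_X_sub_C_of_monic_of_roots_card_eq (p := (X ^ p - X : (ZMod p)[X]))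
      (by
        refine monic_X_pow_sub (n := p) ?_
        rw [degree_X]; exact_mod_cast hp)
      (by
        rw [h1, FiniteField.X_pow_card_sub_X_natDegree_eq _ hp]
        simp)
    rw [← h2, h1]
    rfl
  rw [C_dvd_iff_dvd_coeff]
  intro i
  rw [← ZMod.intCast_zmod_eq_zero_iff_dvd, ← eq_intCast (Int.castRingHom (ZMod p)), ← coeff_map]
  simp only [Polynomial.map_sub, Polynomial.map_pow, map_X, Polynomial.map_prod, map_C, h,
    Int.coe_castRingHom, Int.cast_natCast, ZMod.natCast_zmod_val, sub_self, coeff_zero]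

/-- An integral element satisfying `r ^ p ≡ r` at a place is congruent to an integer: the
polynomial `X ^ p - X` splits over the prime field. -/
theorem Place.exists_int_sub_lt_one (v : Place p R) {r : R} (hr : v.1 r ≤ 1)
    (h : v.1 (r - r ^ p) < 1) : ∃ m : ℤ, v.1 (r - m) < 1 := by
  have hp : (1 : ℝ) < p := by exact_mod_cast (Fact.out : p.Prime).one_lt
  obtain ⟨g, hg⟩ := p_dvd_X_pow_sub_X_sub_prod p
  have hg' := congrArg (Polynomial.aeval r) hg
  have hgr : v.1 (Polynomial.aeval r g) ≤ 1 := by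
    rw [Polynomial.aeval_eq_sum_range]
    refine v.mem_integers.1 (sum_mem fun i _ => ?_)
    rw [zsmul_eq_mul]
    exact mul_mem (v.intCast_mem_integers _) (pow_mem (v.mem_integers.2 hr) i)
  have hlt : v.1 (∏ a : ZMod p, (r - ((a.val : ℤ) : R))) < 1 := by
    have : ∏ a : ZMod p, (r - ((a.val : ℤ) : R)) =
        -(r - r ^ p) - (p : R) * Polynomial.aeval r g := by
      simp only [map_sub, map_mul, map_pow, map_prod, Polynomial.aeval_X, Polynomial.aeval_C] at hg'
      simp only [algebraMap_int_eq, eq_intCast, Int.cast_natCast] at hg' ⊢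
      linear_combination -hg'
    rw [this]
    refine (v.apply_sub_le _ _).trans_lt (max_lt (by rwa [map_neg_eq_map]) ?_)
    rw [map_mul, v.apply_p]
    exact (mul_le_of_le_one_right (by positivity) hgr).trans_lt (inv_lt_one_of_one_lt₀ hp)
  by_contra! hcon
  rw [map_prod] at hlt
  exact hlt.not_ge (Finset.one_le_prod fun a _ => hcon _)

/-- The step of `p`-adic successive approximation: the remainder after splitting off a residue is
`p` times an element with the same integrality property. -/
theorem Place.exists_eq_int_add_p_mul (v : Place p R) {r : R}
    (hr : constWitt p R r ∈ v.wittIntegers) :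
    ∃ (m : ℤ) (s : R), r = m + p * s ∧ constWitt p R s ∈ v.wittIntegers := by
  have hp1 : (1 : ℝ) < p := by exact_mod_cast (Fact.out : p.Prime).one_lt
  have hp0 : (p : ℝ) ≠ 0 := by positivity
  have key : ∀ r : R, constWitt p R r ∈ v.wittIntegers →
      v.1 r ≤ 1 ∧ v.1 (r - r ^ p) ≤ (p : ℝ)⁻¹ := by
    intro r hr
    have h := v.mem_wittIntegers.1 hr
    refine ⟨by simpa using h 0, ?_⟩
    have h1 : r - r ^ p = p * (constWitt p R r).coeff 1 := by
      linear_combination -constWitt_coeff_one p r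
    rw [h1, map_mul, v.apply_p]
    exact mul_le_of_le_one_right (by positivity) (h 1)
  obtain ⟨m, hm⟩ := v.exists_int_sub_lt_one (key r hr).1
    ((key r hr).2.trans_lt (inv_lt_one_of_one_lt₀ hp1))
  have hr' : constWitt p R (r - m) ∈ v.wittIntegers := by
    rw [map_sub, map_intCast]
    exact sub_mem hr (intCast_mem _ m)
  have hle : v.1 (r - m) ≤ (p : ℝ)⁻¹ := by
    -- otherwise `r - m` would dominate its `p`-th power, hence also the difference
    by_contra! hcon
    have h1 := (key _ hr').2
    have hpos : 0 < v.1 (r - m) := lt_trans (by positivity) hcon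
    have h2 : v.1 ((r - m) ^ p) < v.1 (r - m) := by
      rw [map_pow]
      exact pow_lt_self_of_lt_one₀ hpos hm (Fact.out : p.Prime).one_lt
    have h3 := v.2.1 ((r - m) - (r - m) ^ p) ((r - m) ^ p)
    rw [sub_add_cancel] at h3
    exact (h3.trans_lt (max_lt (h1.trans_lt hcon) h2)).false
  obtain ⟨s, hs, hs1⟩ := v.exists_eq_p_pow_mul (n := 1) (by rwa [pow_one])
  rw [pow_one] at hs
  exact ⟨m, s, by rw [← hs]; ring, (v.constWitt_p_mul_mem_iff hs1).1 (hs ▸ hr')⟩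

theorem Place.isLimitOfInt_of_mem_wittIntegers (v : Place p R) {r : R}
    (hr : constWitt p R r ∈ v.wittIntegers) : v.IsLimitOfInt r := by
  intro n
  suffices ∃ (m : ℤ) (s : R), r = m + p ^ n * s ∧ constWitt p R s ∈ v.wittIntegers by
    obtain ⟨m, s, rfl, hs⟩ := this
    refine ⟨m, ?_⟩
    rw [add_sub_cancel_left, map_mul, map_pow, v.apply_p]
    exact mul_le_of_le_one_right (by positivity) (by simpa using v.mem_wittIntegers.1 hs 0)
  induction n with
  | zero => exact ⟨0, r, by simp, hr⟩
  | succ n ih =>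
    obtain ⟨m, s, h, hs⟩ := ih
    obtain ⟨k, t, rfl, ht⟩ := v.exists_eq_int_add_p_mul hs
    exact ⟨m + p ^ n * k, t, by rw [h]; push_cast; ring, ht⟩

/-- Up to a term divisible by `V ^ n`, the Witt vector with constant ghost component `p ^ n * s`
is integral. -/
theorem Place.exists_constWitt_p_pow_mul (v : Place p R) {s : R} (hs : v.1 s ≤ 1) (n : ℕ) :
    ∃ y ∈ v.wittIntegers, constWitt p R (p ^ n * s) =
      WittVector.verschiebung^[n] (constWitt p R s) + y := by
  induction n with
  | zero => exact ⟨0, zero_mem _, by simp⟩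
  | succ n ih =>
    obtain ⟨y, hy, h⟩ := ih
    have hs' : v.1 ((p : R) ^ n * s) ≤ 1 :=
      v.mem_integers.1 (mul_mem (pow_mem (natCast_mem _ _) n) (v.mem_integers.2 hs))
    refine ⟨WittVector.verschiebung y + _, add_mem (v.verschiebung_mem_wittIntegers.2 hy)
      (v.teichmuller_mul_mem_wittIntegers hs'), ?_⟩
    rw [pow_succ', mul_assoc, constWitt_p_mul, h, map_add, Function.iterate_succ_apply', add_assoc]

/-- All components of the Witt vector with constant ghost components `r` are integral at a place
if and only if `r` is a limit of integers there. -/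
theorem Place.constWitt_mem_wittIntegers_iff (v : Place p R) {r : R} :
    constWitt p R r ∈ v.wittIntegers ↔ v.IsLimitOfInt r := by
  refine ⟨v.isLimitOfInt_of_mem_wittIntegers, fun h => v.mem_wittIntegers.2 fun i => ?_⟩
  obtain ⟨m, hm⟩ := h (i + 1)
  obtain ⟨s, hs, hs1⟩ := v.exists_eq_p_pow_mul hm
  obtain ⟨y, hy, hys⟩ := v.exists_constWitt_p_pow_mul hs1 (i + 1)
  have hr : constWitt p R r =
      WittVector.verschiebung^[i + 1] (constWitt p R s) + (y + (m : WittVector p R)) := by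
    rw [← add_assoc, ← hys, ← hs, map_sub, map_intCast, sub_add_cancel]
  have hz :
      WittVector.truncate (i + 1) (WittVector.verschiebung^[i + 1] (constWitt p R s)) = 0 := by
    rw [← RingHom.mem_ker, WittVector.mem_ker_truncate]
    exact fun j hj => WittVector.iterate_verschiebung_coeff_eq_zero _ hj
  have hc : (constWitt p R r).coeff i = (y + (m : WittVector p R)).coeff i := by
    have := congrArg (TruncatedWittVector.coeff ⟨i, Nat.lt_succ_self i⟩)
      (congrArg (WittVector.truncate (i + 1)) hr)
    rwa [map_add, hz, zero_add, WittVector.coeff_truncate, WittVector.coeff_truncate] at this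
  rw [hc]
  exact v.mem_wittIntegers.1 (add_mem hy (intCast_mem _ m)) i

end Integrality

/-! ### Frobenius-invariant elements of the inverse limit -/

section FrobeniusInvariants

variable (p : ℕ) [Fact p.Prime] {R : Type*} [CommRing R] [Algebra ℚ R]

variable (R) in
/-- The ring homomorphism sending an element `r` of a `ℚ`-algebra to the system of truncations of
the Witt vector with constant ghost components `r`. -/
noncomputable def constWArrow : R →+* WArrow p R :=
  (RingHom.pi fun n => (WittVector.truncate (n + 1)).comp (constWitt p R)).codRestrict
    (WArrow p R) fun r n => by
      change truncFrobenius p (n + 1) (WittVector.truncate (n + 2) (constWitt p R r)) = _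
      rw [truncFrobenius_truncate, frobenius_constWitt]
      rfl

theorem constWArrow_apply (r : R) (n : ℕ) :
    (constWArrow p R r).1 n = WittVector.truncate (n + 1) (constWitt p R r) := rfl

theorem constWArrow_coeff (r : R) (n : ℕ) (i : Fin (n + 1)) :
    ((constWArrow p R r).1 n).coeff i = (constWitt p R r).coeff i :=
  WittVector.coeff_truncate _ _

theorem constWArrow_injective : Function.Injective (constWArrow p R) := fun r s h => by
  have := congrArg (fun x : WArrow p R => (x.1 0).coeff 0) h
  simpa [constWArrow_coeff] using this

theorem phiInv_constWArrow (r : R) : phiInv p (constWArrow p R r) = constWArrow p R r := by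
  ext1; funext n
  exact TruncatedWittVector.truncate_wittVector_truncate _ _

/-- An element of the inverse limit fixed by `φ⁻¹` is given by the truncations of one
Frobenius-fixed Witt vector. -/
theorem exists_eq_constWArrow {x : WArrow p R} (hx : phiInv p x = x) :
    ∃ r, x = constWArrow p R r := by
  have hres : ∀ n, TruncatedWittVector.truncate (Nat.le_succ (n + 1)) (x.1 (n + 1)) = x.1 n :=
    fun n => congrFun (congrArg Subtype.val hx) n
  -- the restriction maps are compatible, so the top components glue to one Witt vector
  let X : WittVector p R := WittVector.mk p fun i => (x.1 i).coeff (Fin.last i)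
  have hcoeff : ∀ (n i : ℕ) (hi : i < n + 1), (x.1 n).coeff ⟨i, hi⟩ = X.coeff i := by
    intro n
    induction n with
    | zero => intro i hi; obtain rfl : i = 0 := by omega
              rfl
    | succ n ih =>
      intro i hi
      rcases Nat.lt_succ_iff_lt_or_eq.1 hi with h | rfl
      · rw [← ih i h, ← hres n, TruncatedWittVector.coeff_truncate]; rfl
      · rfl
  have hX : ∀ n, x.1 n = WittVector.truncate (n + 1) X := fun n =>
    TruncatedWittVector.ext fun i => by
      rw [WittVector.coeff_truncate]; exact hcoeff n i i.2
  have hF : WittVector.frobenius X = X := by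
    ext i
    have h := x.2 i
    rw [hX, hX, truncFrobenius_truncate] at h
    simpa only [WittVector.coeff_truncate, Fin.val_last] using
      congrArg (TruncatedWittVector.coeff (Fin.last i)) h
  refine ⟨X.coeff 0, ?_⟩
  ext1; funext n
  rw [hX, constWArrow_apply, ← eq_constWitt_of_frobenius_eq p hF]

theorem map_constWArrow {S : Type*} [CommRing S] [Algebra ℚ S] (f : R →+* S) (r : R) :
    WArrow.map p f (constWArrow p R r) = constWArrow p S (f r) := by
  ext1; funext n
  change truncMap p (n + 1) f (WittVector.truncate (n + 1) (constWitt p R r)) = _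
  rw [truncMap_truncate, map_constWitt]
  rfl

end FrobeniusInvariants

/-! ### Overconvergence of constant systems -/

section Overconvergence

variable (p : ℕ) [Fact p.Prime]

/-- Doubly exponential growth beats every exponential decay. -/
theorem not_tendsto_rpow_neg_mul_pow_pow {b c : ℝ} (hc : 1 < c) (i : ℕ) :
    ¬ Filter.Tendsto (fun n : ℕ => (p : ℝ) ^ (-(b * n)) * c ^ p ^ (n - i)) Filter.atTop
      (nhds 0) := by
  intro h
  have hp1 : (1 : ℝ) < p := by exact_mod_cast (Fact.out : p.Prime).one_lt
  have hp0 : (0 : ℝ) < p := by positivity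
  have hlog : 0 < Real.log c := Real.log_pos hc
  have h1 := (tendsto_pow_const_div_const_pow_of_one_lt 1 hp1).const_mul (b * Real.log p)
  have h0 := (tendsto_pow_const_div_const_pow_of_one_lt 0 hp1).const_mul (b * i * Real.log p)
  have hlim := h1.add h0
  rw [mul_zero, mul_zero, add_zero] at hlim
  obtain ⟨m, hm, hm'⟩ := ((hlim.eventually_lt_const hlog).and
    ((h.comp (Filter.tendsto_add_atTop_nat i)).eventually_lt_const one_pos)).exists
  simp only [Function.comp_apply, Nat.add_sub_cancel] at hm'
  have hpm : (0 : ℝ) < (p : ℝ) ^ m := by positivity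
  have h2 := Real.log_neg (by positivity) hm'
  rw [Real.log_mul (by positivity) (by positivity), Real.log_rpow hp0, Real.log_pow] at h2
  have h3 : b * Real.log p * ((m : ℝ) ^ 1 / (p : ℝ) ^ m) +
      b * i * Real.log p * ((m : ℝ) ^ 0 / (p : ℝ) ^ m) =
      b * (m + i) * Real.log p / (p : ℝ) ^ m := by
    field_simp
  rw [h3, div_lt_iff₀ hpm] at hm
  push_cast at h2
  linarith

variable {p} {R : Type*} [CommRing R] [Algebra ℚ R]

/-- The growth allowed to the `n`-th term is exponential in `n`, while a component of norm greater
than one would contribute doubly exponential growth. -/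
theorem isOverconvergentAt_constWArrow_iff (v : RingSeminorm R) {b : ℝ} (hb : 0 < b) (r : R) :
    IsOverconvergentAt p v b (constWArrow p R r) ↔ ∀ i, v ((constWitt p R r).coeff i) ≤ 1 := by
  have hp : (0 : ℝ) < p := by exact_mod_cast (Fact.out : p.Prime).pos
  constructor
  · intro h i
    by_contra! hlt
    refine not_tendsto_rpow_neg_mul_pow_pow p (b := b) hlt i
      (squeeze_zero' (.of_forall fun n => ?_) ?_ h)
    · have := apply_nonneg v ((constWitt p R r).coeff i)
      positivity
    · filter_upwards [Filter.eventually_ge_atTop i] with n hn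
      refine mul_le_mul_of_nonneg_left ?_ (by positivity)
      have h1 := (wittNorm_le_iff p v ((constWArrow p R r).1 n)
        (wittNorm_nonneg p v _)).1 le_rfl ⟨i, Nat.lt_succ_of_le hn⟩
      rw [constWArrow_coeff] at h1
      calc v ((constWitt p R r).coeff i) ^ p ^ (n - i)
          ≤ (wittNorm p v ((constWArrow p R r).1 n) ^ p ^ i) ^ p ^ (n - i) :=
            pow_le_pow_left₀ (apply_nonneg _ _) h1 _
        _ = _ := by rw [← pow_mul, ← pow_add, Nat.add_sub_cancel' hn]
  · intro h
    refine squeeze_zero (fun n => ?_) (fun n => ?_) (tendsto_rpow_neg p hb)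
    · have := wittNorm_nonneg p v ((constWArrow p R r).1 n); positivity
    · refine mul_le_of_le_one_right (by positivity) (pow_le_one₀ (wittNorm_nonneg p v _) ?_)
      rw [wittNorm_le_iff p v _ zero_le_one]
      intro i
      rw [constWArrow_coeff, one_pow]
      exact h i

variable [Algebra.IsIntegral ℚ R]

theorem supSeminorm_le_one_iff (x : R) : supSeminorm p R x ≤ 1 ↔ ∀ v : Place p R, v.1 x ≤ 1 :=
  ⟨fun h v => (le_ciSup (place_bddAbove p x) v).trans h, fun h => Real.iSup_le h zero_le_one⟩

theorem constWArrow_mem_WDagger_iff (r : R) :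
    constWArrow p R r ∈ WDagger p R ↔ ∀ v : Place p R, v.IsLimitOfInt r := by
  have h : constWArrow p R r ∈ WDagger p R ↔
      ∀ i, supSeminorm p R ((constWitt p R r).coeff i) ≤ 1 :=
    ⟨fun ⟨_, hb, h⟩ => (isOverconvergentAt_constWArrow_iff _ hb r).1 h,
      fun h => ⟨1, one_pos, (isOverconvergentAt_constWArrow_iff _ one_pos r).2 h⟩⟩
  simp only [h, supSeminorm_le_one_iff, ← Place.constWitt_mem_wittIntegers_iff,
    Place.mem_wittIntegers]
  exact forall_comm

end Overconvergence

/-! ### Galois invariants -/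

section GaloisInvariants

instance isGalois_maxAbelianExtension (K : Type*) [Field K] [CharZero K] :
    IsGalois K (maxAbelianExtension K) := by
  have : Normal K (maxAbelianExtension K) := by
    rw [maxAbelianExtension, sSup_eq_iSup']
    have (E : {E : IntermediateField K (AlgebraicClosure K) | IsAbelianGalois K E}) :
        Normal K E.1 := by
      have : IsAbelianGalois K E.1 := E.2
      infer_instance
    infer_instance
  constructor

instance isGalois_Qab : IsGalois ℚ Qab := by
  have h := isGalois_maxAbelianExtension ℚ
  have e : (DivisionRing.toRatAlgebra : Algebra ℚ (maxAbelianExtension ℚ)) =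
      (maxAbelianExtension ℚ).algebra' := Subsingleton.elim _ _
  change @IsGalois ℚ _ (maxAbelianExtension ℚ) _ DivisionRing.toRatAlgebra
  rw [e]
  exact h

variable (F : Type*) [Field F] [NumberField F]

theorem gammaAct_tmul (σ : Gal(Qab/ℚ)) (a : F) (b : Qab) :
    gammaAct F σ (a ⊗ₜ b) = a ⊗ₜ σ b := rfl

/-- In a basis of `F` over `ℚ`, the group `Γ` acts on coordinates in `ℚᵃᵇ`, and its fixed field
there is `ℚ`. -/
theorem exists_eq_tmul_one_of_gammaAct_eq {x : F ⊗[ℚ] Qab} (hx : ∀ σ, gammaAct F σ x = x) :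
    ∃ a : F, x = a ⊗ₜ 1 := by
  let b := Module.finBasis ℚ F
  obtain ⟨c, rfl⟩ := TensorProduct.eq_repr_basis_left b x
  have hc : ∀ i, ∃ q : ℚ, algebraMap ℚ Qab q = c i := by
    intro i
    refine (InfiniteGalois.mem_range_algebraMap_iff_fixed (c i)).2 fun σ => ?_
    have h := hx σ
    simp only [Finsupp.sum_fintype, TensorProduct.tmul_zero, implies_true, map_sum,
      gammaAct_tmul] at h
    have h2 := TensorProduct.sum_tmul_basis_left_eq_zero b
      (Finsupp.equivFunOnFinite.symm fun i => σ (c i) - c i) (by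
        simp only [Finsupp.sum_fintype, TensorProduct.tmul_zero, implies_true,
          Finsupp.equivFunOnFinite_symm_apply_apply, TensorProduct.tmul_sub,
          Finset.sum_sub_distrib, h, sub_self])
    exact sub_eq_zero.1 (DFunLike.congr_fun h2 i)
  choose q hq using hc
  refine ⟨∑ i, q i • b i, ?_⟩
  simp only [Finsupp.sum_fintype, TensorProduct.tmul_zero, implies_true, TensorProduct.sum_tmul]
  refine Finset.sum_congr rfl fun i _ => ?_
  rw [← hq, Algebra.algebraMap_eq_smul_one, TensorProduct.tmul_smul, TensorProduct.smul_tmul']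

variable (p : ℕ) [Fact p.Prime]

/-- The elements of `F` which are limits of integers at all places of `F ⊗ ℚᵃᵇ` above `p`. -/
noncomputable def limitOfIntSubring : Subring F :=
  ((WDagger p (F ⊗[ℚ] Qab)).comap (constWArrow p (F ⊗[ℚ] Qab))).comap
    (Algebra.TensorProduct.includeLeftRingHom : F →+* F ⊗[ℚ] Qab)

variable {F} in
theorem mem_limitOfIntSubring {a : F} :
    a ∈ limitOfIntSubring F p ↔ ∀ v : Place p (F ⊗[ℚ] Qab), v.IsLimitOfInt (a ⊗ₜ 1) :=
  constWArrow_mem_WDagger_iff (a ⊗ₜ[ℚ] (1 : Qab))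

/-- The `(φ⁻¹, Γ)`-invariants are the constant systems attached to the elements of `F` which are
limits of integers at all places above `p`. -/
theorem nonempty_invariants_equiv : Nonempty (invariants p F ≃+* limitOfIntSubring F p) := by
  let f : F →+* WArrow p (F ⊗[ℚ] Qab) :=
    (constWArrow p (F ⊗[ℚ] Qab)).comp Algebra.TensorProduct.includeLeftRingHom
  have hf : Function.Injective f := fun a b h =>
    (Algebra.TensorProduct.includeLeftRingHom : F →+* F ⊗[ℚ] Qab).injective
      (constWArrow_injective p h)
  have hmap : invariants p F = (limitOfIntSubring F p).map f := by
    ext x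
    constructor
    · rintro ⟨h1, h2, h3⟩
      obtain ⟨r, rfl⟩ := exists_eq_constWArrow p h2
      obtain ⟨a, rfl⟩ := exists_eq_tmul_one_of_gammaAct_eq F fun σ =>
        constWArrow_injective p ((map_constWArrow p _ _).symm.trans (h3 σ))
      exact ⟨a, h1, rfl⟩
    · rintro ⟨a, ha, rfl⟩
      refine ⟨ha, phiInv_constWArrow p _, fun σ => ?_⟩
      change WArrow.map p (gammaAct F σ) (constWArrow p _ (a ⊗ₜ[ℚ] (1 : Qab))) = _
      rw [map_constWArrow, gammaAct_tmul, map_one]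
      rfl
  exact ⟨(RingEquiv.subringCongr hmap).trans
    ((limitOfIntSubring F p).equivMapOfInjective f hf).symm⟩

end GaloisInvariants

/-! ### Places of number fields -/

section Places

variable {p : ℕ} [Fact p.Prime] {R S : Type*} [CommRing R] [Algebra ℚ R] [CommRing S] [Algebra ℚ S]

/-- The pullback of a place along a ring homomorphism. -/
def Place.comap (v : Place p S) (f : R →+* S) : Place p R where
  val :=
    { toFun := fun x => v.1 (f x)
      map_zero' := by simp
      map_one' := by simp
      map_mul' := by simp
      add_le' := fun x y => by rw [map_add]; exact map_add_le_add _ _ _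
      neg' := fun x => by rw [map_neg, map_neg_eq_map] }
  property := ⟨fun x y => by
      change v.1 (f (x + y)) ≤ max (v.1 (f x)) (v.1 (f y))
      rw [map_add]
      exact v.2.1 _ _, fun q => by
      change v.1 (f.comp (algebraMap ℚ R) q) = _
      rw [Subsingleton.elim (f.comp (algebraMap ℚ R)) (algebraMap ℚ S), v.2.2]⟩

@[simp]
theorem Place.comap_apply (v : Place p S) (f : R →+* S) (x : R) : (v.comap f).1 x = v.1 (f x) := rfl

theorem Place.isLimitOfInt_comap_iff (v : Place p S) (f : R →+* S) (x : R) :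
    (v.comap f).IsLimitOfInt x ↔ v.IsLimitOfInt (f x) := by
  simp only [Place.IsLimitOfInt, Place.comap_apply, map_sub, map_intCast]

theorem Place.le_one_of_isIntegral (v : Place p R) {x : R} (hx : IsIntegral ℤ x) : v.1 x ≤ 1 := by
  obtain ⟨f, hf, hfx⟩ := hx
  by_contra! hlt
  rw [Polynomial.eval₂_eq_sum_range, Finset.sum_range_succ, hf.coeff_natDegree, map_one,
    one_mul] at hfx
  have hx' := congrArg v.1 (eq_neg_of_add_eq_zero_right hfx)
  rw [map_neg_eq_map, map_pow] at hx'
  rcases Nat.eq_zero_or_pos f.natDegree with h0 | h0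
  · simp [h0] at hx'
  · obtain ⟨i, hi, hle⟩ := v.2.1.finset_image_add_of_nonempty
      (fun i => algebraMap ℤ R (f.coeff i) * x ^ i) (Finset.nonempty_range_iff.2 h0.ne')
    refine absurd (hx'.trans_le hle) (not_le.2 ?_)
    rw [map_mul, map_pow, eq_intCast]
    exact (mul_le_of_le_one_left (by positivity) (v.apply_intCast_le_one _)).trans_lt
      (pow_lt_pow_right₀ hlt (Finset.mem_range.1 hi))

theorem Place.apply_intCast_lt_one_iff (v : Place p R) (m : ℤ) : v.1 (m : R) < 1 ↔ (p : ℤ) ∣ m := by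
  rw [v.apply_intCast, ← padicNorm.int_lt_one_iff]
  norm_cast

theorem Place.apply_intCast_eq_one (v : Place p R) {m : ℤ} (hm : ¬ (p : ℤ) ∣ m) :
    v.1 (m : R) = 1 :=
  (v.apply_intCast_le_one m).eq_of_not_lt fun h => hm ((v.apply_intCast_lt_one_iff m).1 h)

theorem Place.IsLimitOfInt.le_one {v : Place p R} {r : R} (h : v.IsLimitOfInt r) : v.1 r ≤ 1 := by
  obtain ⟨m, hm⟩ := h 0
  rw [pow_zero] at hm
  have := v.2.1 (r - m) m
  rw [sub_add_cancel] at this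
  exact this.trans (max_le hm (v.apply_intCast_le_one m))

/-- Integers prime to `p` are invertible modulo `p ^ n`, so they may be divided out of limits of
integers. -/
theorem Place.isLimitOfInt_of_intCast_mul {v : Place p R} {m : ℤ} (hm : ¬ (p : ℤ) ∣ m) {r : R}
    (h : v.IsLimitOfInt (m * r)) : v.IsLimitOfInt r := by
  intro n
  obtain ⟨k, hk⟩ := h n
  have hcop : IsCoprime m ((p : ℤ) ^ n) :=
    ((Nat.prime_iff_prime_int.1 Fact.out).coprime_iff_not_dvd.2 hm).symm.pow_right
  obtain ⟨d, e, hde⟩ := hcop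
  refine ⟨d * k, ?_⟩
  have hdeR : (d : R) * m + e * (p : R) ^ n = 1 := by exact_mod_cast congrArg (Int.cast : ℤ → R) hde
  have heq : (m : R) * (r - (d * k : ℤ)) = (m * r - k) - (-(e * k : ℤ)) * p ^ n := by
    push_cast
    linear_combination (-(k : R)) * hdeR
  rw [← one_mul (v.1 _), ← v.apply_intCast_eq_one hm, ← map_mul, heq]
  refine (v.apply_sub_le _ _).trans (max_le hk ?_)
  rw [map_mul, map_pow, v.apply_p, map_neg_eq_map]
  exact mul_le_of_le_one_left (by positivity) (v.apply_intCast_le_one _)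

end Places

/-! ### Complete splitting and limits of integers -/

section Splitting

variable {p : ℕ} [Fact p.Prime] {E : Type*} [Field E] [NumberField E]

open NumberField

theorem Place.apply_ringOfIntegers_le_one (v : Place p E) (x : 𝓞 E) :
    v.1 (algebraMap (𝓞 E) E x) ≤ 1 :=
  v.le_one_of_isIntegral x.isIntegral_coe

/-- The prime ideal of the ring of integers cut out by a place of a number field. -/
def Place.center (v : Place p E) : Ideal (𝓞 E) where
  carrier := {x | v.1 (algebraMap (𝓞 E) E x) < 1}
  zero_mem' := by simp
  add_mem' {x y} hx hy :=
    (v.2.1 (algebraMap (𝓞 E) E x) (algebraMap (𝓞 E) E y)).trans_lt (max_lt hx hy)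
  smul_mem' c x hx := by
    change v.1 (algebraMap (𝓞 E) E (c * x)) < 1
    rw [map_mul, map_mul]
    exact mul_lt_one_of_nonneg_of_lt_one_right (v.apply_ringOfIntegers_le_one c)
      (apply_nonneg _ _) hx

theorem Place.mem_center (v : Place p E) {x : 𝓞 E} :
    x ∈ v.center ↔ v.1 (algebraMap (𝓞 E) E x) < 1 := Iff.rfl

instance Place.isPrime_center (v : Place p E) : v.center.IsPrime where
  ne_top' := by
    rw [Ideal.ne_top_iff_one, v.mem_center]
    simp
  mem_or_mem' {x y} h := by
    by_contra! hcon
    rw [v.mem_center, v.mem_center, not_lt, not_lt] at hcon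
    rw [v.mem_center, map_mul, map_mul] at h
    exact h.not_ge (one_le_mul_of_one_le_of_one_le hcon.1 hcon.2)

theorem isMaximal_span_p : (Ideal.span {(p : ℤ)}).IsMaximal :=
  PrincipalIdealRing.isMaximal_of_irreducible
    (Nat.prime_iff_prime_int.1 (Fact.out : p.Prime)).irreducible

instance Place.liesOver_center (v : Place p E) : v.center.LiesOver (Ideal.span {(p : ℤ)}) :=
  ⟨by
    ext m
    rw [Ideal.mem_span_singleton, ← v.apply_intCast_lt_one_iff, Ideal.under_def, Ideal.mem_comap,
      v.mem_center]
    simp⟩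

theorem Place.center_mem_primesOver (v : Place p E) :
    v.center ∈ (Ideal.span {(p : ℤ)}).primesOver (𝓞 E) :=
  ⟨inferInstance, inferInstance⟩

instance Place.isMaximal_center (v : Place p E) : v.center.IsMaximal :=
  have := isMaximal_span_p (p := p)
  Ideal.IsMaximal.of_liesOver_isMaximal v.center (Ideal.span {(p : ℤ)})

theorem Place.map_span_le_center (v : Place p E) :
    (Ideal.span {(p : ℤ)}).map (algebraMap ℤ (𝓞 E)) ≤ v.center :=
  Ideal.map_le_iff_le_comap.2 (Ideal.over_def v.center (Ideal.span {(p : ℤ)})).le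

theorem span_p_ne_bot : Ideal.span {(p : ℤ)} ≠ ⊥ := by
  rw [Ne, Ideal.span_singleton_eq_bot]
  exact_mod_cast (Fact.out : p.Prime).ne_zero

/-- The residue degree is one if and only if every integer of `E` is congruent to a rational
integer. -/
theorem Place.inertiaDeg_center_eq_one_iff (v : Place p E) :
    v.center.inertiaDeg ℤ = 1 ↔ ∀ x : 𝓞 E, ∃ m : ℤ, v.1 (algebraMap (𝓞 E) E x - m) < 1 := by
  have := isMaximal_span_p (p := p)
  let : Field (ℤ ⧸ Ideal.span {(p : ℤ)}) := Ideal.Quotient.field _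
  rw [Ideal.inertiaDeg_eq_of_isMaximal (Ideal.span {(p : ℤ)}),
    finrank_eq_one_iff_of_nonzero' (1 : 𝓞 E ⧸ v.center) one_ne_zero]
  have hmem : ∀ (x : 𝓞 E) (m : ℤ), Ideal.Quotient.mk v.center (m : 𝓞 E) =
      Ideal.Quotient.mk v.center x ↔ v.1 (algebraMap (𝓞 E) E x - m) < 1 := by
    intro x m
    rw [eq_comm, Ideal.Quotient.mk_eq_mk_iff_sub_mem, v.mem_center]
    simp
  constructor
  · intro h x
    obtain ⟨c, hc⟩ := h (Ideal.Quotient.mk _ x)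
    obtain ⟨m, rfl⟩ := Ideal.Quotient.mk_surjective c
    exact ⟨m, (hmem x m).1 (by rw [← hc, Algebra.smul_def, mul_one]; simp)⟩
  · intro h w
    obtain ⟨x, rfl⟩ := Ideal.Quotient.mk_surjective w
    obtain ⟨m, hm⟩ := h x
    exact ⟨Ideal.Quotient.mk _ m, by
      rw [← (hmem x m).2 hm, Algebra.smul_def, mul_one]; simp⟩

/-- The centre of a place is ramified over `p` if and only if its square contains `p`. -/
theorem Place.ramificationIdx_center_ne_one_iff (v : Place p E) :
    v.center.ramificationIdx ℤ ≠ 1 ↔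
      (Ideal.span {(p : ℤ)}).map (algebraMap ℤ (𝓞 E)) ≤ v.center ^ 2 := by
  rw [← Ideal.ramificationIdx'_eq_ramificationIdx (Ideal.span {(p : ℤ)}) v.center span_p_ne_bot,
    Ideal.ramificationIdx'_ne_one_iff v.map_span_le_center]

/-- If `p` splits completely in `E`, then the integers of `E` are limits of rational integers at
every place above `p`. -/
theorem SplitsCompletely.isLimitOfInt (hE : SplitsCompletely p E) (v : Place p E) (x : 𝓞 E) :
    v.IsLimitOfInt (algebraMap (𝓞 E) E x) := by
  obtain ⟨he, hf⟩ := hE v.center v.center_mem_primesOver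
  have hf' := v.inertiaDeg_center_eq_one_iff.1 hf
  have he' := mt v.ramificationIdx_center_ne_one_iff.2 (not_not.2 he)
  obtain ⟨J, hJ⟩ := Ideal.dvd_iff_le.2 v.map_span_le_center
  have hJP : ¬ J ≤ v.center := fun h => he' (by
    rw [hJ, pow_two]; exact Ideal.mul_mono_right h)
  -- the two factors of `p` are coprime; elements of the second one carry the centre into `(p)`
  obtain ⟨a, ha, c, hc, hac⟩ := Submodule.mem_sup.1 (show (1 : 𝓞 E) ∈ v.center ⊔ J by
    rw [v.isMaximal_center.out.2 _ (left_lt_sup.2 hJP)]; trivial)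
  have hmul : ∀ z ∈ v.center, ∀ d ∈ J, ∃ y : 𝓞 E, d * z = p * y := by
    intro z hz d hd
    have h := Ideal.mul_mem_mul hz hd
    rw [← hJ, Ideal.map_span, Set.image_singleton, Ideal.mem_span_singleton] at h
    obtain ⟨y, hy⟩ := h
    exact ⟨y, by rw [mul_comm, hy]; simp⟩
  have hc1 : v.1 (algebraMap (𝓞 E) E c) = 1 := by
    refine (v.apply_ringOfIntegers_le_one c).eq_of_not_lt fun h => ?_
    have h1 := v.center.add_mem ha (v.mem_center.2 h)
    rw [hac] at h1
    exact v.isPrime_center.ne_top ((Ideal.eq_top_iff_one _).2 h1)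
  have ha1 : v.1 (algebraMap (𝓞 E) E a) ≤ (p : ℝ)⁻¹ := by
    obtain ⟨y, hy⟩ := hmul a ha c hc
    have h := congrArg (fun t => v.1 (algebraMap (𝓞 E) E t)) hy
    simp only [map_mul, hc1, one_mul, map_natCast, v.apply_p] at h
    rw [h]
    exact mul_le_of_le_one_right (by positivity) (v.apply_ringOfIntegers_le_one y)
  intro n
  induction n generalizing x with
  | zero => exact ⟨0, by simpa using v.apply_ringOfIntegers_le_one x⟩
  | succ n ih =>
    obtain ⟨m, hm⟩ := hf' x
    have hz : x - m ∈ v.center := by rw [v.mem_center]; simpa using hm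
    -- multiplication by `1 - a ^ (n + 1)` is the identity up to an error of size `p ^ (-(n + 1))`
    have hd : 1 - a ^ (n + 1) ∈ J := by
      rw [← Ideal.Quotient.eq_zero_iff_mem, map_sub, map_pow, eq_sub_of_add_eq hac, map_sub,
        Ideal.Quotient.eq_zero_iff_mem.2 hc]
      simp
    obtain ⟨y, hy⟩ := hmul _ hz _ hd
    obtain ⟨k, hk⟩ := ih y
    refine ⟨m + p * k, ?_⟩
    have heq : algebraMap (𝓞 E) E x - ((m + p * k : ℤ) : E) = p * (algebraMap (𝓞 E) E y - k) +
        algebraMap (𝓞 E) E a ^ (n + 1) * algebraMap (𝓞 E) E (x - m) := by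
      have h := congrArg (algebraMap (𝓞 E) E) hy
      simp only [map_mul, map_sub, map_pow, map_one, map_natCast, map_intCast] at h ⊢
      push_cast
      linear_combination h
    rw [heq]
    refine (v.2.1 _ _).trans (max_le ?_ ?_)
    · rw [map_mul, v.apply_p, pow_succ']
      exact mul_le_mul_of_nonneg_left hk (by positivity)
    · rw [map_mul, map_pow]
      exact (mul_le_of_le_one_right (by positivity) (v.apply_ringOfIntegers_le_one _)).trans
        (pow_le_pow_left₀ (apply_nonneg _ _) ha1 _)

/-- In a Galois extension, a single place at which all integers of `E` are limits of rational
integers suffices for `p` to split completely. -/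
theorem splitsCompletely_of_isLimitOfInt [IsGalois ℚ E] (v : Place p E)
    (h : ∀ x : 𝓞 E, v.IsLimitOfInt (algebraMap (𝓞 E) E x)) : SplitsCompletely p E := by
  have hp : (1 : ℝ) < p := by exact_mod_cast (Fact.out : p.Prime).one_lt
  have hf : v.center.inertiaDeg ℤ = 1 := v.inertiaDeg_center_eq_one_iff.2 fun x => by
    obtain ⟨m, hm⟩ := h x 1
    exact ⟨m, hm.trans_lt (by rw [pow_one]; exact inv_lt_one_of_one_lt₀ hp)⟩
  have hP : ∀ x ∈ v.center, v.1 (algebraMap (𝓞 E) E x) ≤ (p : ℝ)⁻¹ := by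
    intro x hx
    obtain ⟨m, hm⟩ := h x 1
    rw [pow_one] at hm
    have hm1 : v.1 (m : E) < 1 := by
      have := v.apply_sub_le (algebraMap (𝓞 E) E x) (algebraMap (𝓞 E) E x - m)
      rw [sub_sub_cancel] at this
      exact this.trans_lt (max_lt hx (hm.trans_lt (inv_lt_one_of_one_lt₀ hp)))
    obtain ⟨k, rfl⟩ := (v.apply_intCast_lt_one_iff m).1 hm1
    have hk : v.1 (((p : ℤ) * k : ℤ) : E) ≤ (p : ℝ)⁻¹ := by
      push_cast
      rw [map_mul, v.apply_p]
      exact mul_le_of_le_one_right (by positivity) (v.apply_intCast_le_one k)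
    have := v.2.1 (algebraMap (𝓞 E) E x - (((p : ℤ) * k : ℤ) : E)) (((p : ℤ) * k : ℤ) : E)
    rw [sub_add_cancel] at this
    exact this.trans (max_le hm hk)
  have he : v.center.ramificationIdx ℤ = 1 := by
    by_contra hne
    have hle := v.ramificationIdx_center_ne_one_iff.1 hne
    have hmem : (p : 𝓞 E) ∈ v.center ^ 2 := by
      have := hle (Ideal.mem_map_of_mem _ (Ideal.mem_span_singleton_self (p : ℤ)))
      simpa using this
    have hsq : ∀ y ∈ v.center ^ 2, v.1 (algebraMap (𝓞 E) E y) ≤ (p : ℝ)⁻¹ * (p : ℝ)⁻¹ := by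
      intro y hy
      rw [pow_two] at hy
      refine Submodule.mul_induction_on hy (fun a ha b hb => ?_) (fun a b ha hb => ?_)
      · rw [map_mul, map_mul]
        exact mul_le_mul (hP a ha) (hP b hb) (apply_nonneg _ _) (by positivity)
      · rw [map_add]
        exact (v.2.1 _ _).trans (max_le ha hb)
    have h1 := hsq _ hmem
    rw [map_natCast, v.apply_p] at h1
    have h2 : (p : ℝ)⁻¹ * (p : ℝ)⁻¹ < (p : ℝ)⁻¹ :=
      mul_lt_of_lt_one_right (by positivity) (inv_lt_one_of_one_lt₀ hp)
    exact h1.not_gt h2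
  rintro P ⟨hP1, hP2⟩
  rw [Ideal.ramificationIdx_eq_of_isGaloisGroup (Ideal.span {(p : ℤ)}) P v.center Gal(E/ℚ),
    Ideal.inertiaDeg_eq_of_isGaloisGroup (Ideal.span {(p : ℤ)}) P v.center Gal(E/ℚ)]
  exact ⟨he, hf⟩

end Splitting

/-! ### Embeddings into the algebraic closure of the `p`-adic numbers -/

section Padic

variable (p : ℕ) [Fact p.Prime]

/-- The place of the algebraic closure of `ℚ_p` given by its norm. -/
noncomputable def normPlace : Place p (PadicAlgCl p) where
  val :=
    { toFun := fun x => ‖x‖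
      map_zero' := norm_zero
      map_one' := norm_one
      map_mul' := norm_mul
      add_le' := norm_add_le
      neg' := norm_neg }
  property := ⟨PadicAlgCl.isNonarchimedean p, fun q => by
    change ‖algebraMap ℚ (PadicAlgCl p) q‖ = _
    rw [eq_ratCast, ← map_ratCast (algebraMap ℚ_[p] (PadicAlgCl p)), norm_algebraMap',
      Padic.eq_padicNorm]⟩

theorem normPlace_apply (x : PadicAlgCl p) : (normPlace p).1 x = ‖x‖ := rfl

variable {p}

theorem inv_p_lt_one : (p : ℝ)⁻¹ < 1 :=
  inv_lt_one_of_one_lt₀ (by exact_mod_cast (Fact.out : p.Prime).one_lt)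

/-- A limit of integers lies in `ℚ_p`, by completeness. -/
theorem mem_fieldRange_of_isLimitOfInt {y : PadicAlgCl p} (hy : (normPlace p).IsLimitOfInt y) :
    y ∈ (algebraMap ℚ_[p] (PadicAlgCl p)).fieldRange := by
  have hclosed : IsClosed (Set.range (algebraMap ℚ_[p] (PadicAlgCl p))) :=
    (algebraMap_isometry ℚ_[p] (PadicAlgCl p)).isClosedEmbedding.isClosed_range
  refine hclosed.closure_subset (Metric.mem_closure_iff.2 fun ε hε => ?_)
  obtain ⟨n, hn⟩ := exists_pow_lt_of_lt_one hε (inv_p_lt_one (p := p))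
  obtain ⟨m, hm⟩ := hy n
  refine ⟨m, ⟨m, map_intCast _ m⟩, ?_⟩
  rw [dist_eq_norm]
  exact hm.trans_lt hn

/-- An integral element of `ℚ_p` is a limit of integers. -/
theorem isLimitOfInt_of_mem_fieldRange {y : PadicAlgCl p}
    (hy : y ∈ (algebraMap ℚ_[p] (PadicAlgCl p)).fieldRange) (h1 : ‖y‖ ≤ 1) :
    (normPlace p).IsLimitOfInt y := by
  obtain ⟨z, rfl⟩ := hy
  rw [norm_algebraMap'] at h1
  obtain ⟨w, rfl⟩ : ∃ w : ℤ_[p], (w : ℚ_[p]) = z := ⟨⟨z, h1⟩, rfl⟩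
  intro n
  have hp : (0 : ℝ) < (p : ℝ)⁻¹ ^ n :=
    pow_pos (inv_pos.2 (by exact_mod_cast (Fact.out : p.Prime).pos)) n
  obtain ⟨m, hm⟩ := (PadicInt.denseRange_intCast (p := p)).exists_dist_lt w hp
  refine ⟨m, ?_⟩
  rw [normPlace_apply, ← map_intCast (algebraMap ℚ_[p] (PadicAlgCl p)), ← map_sub,
    norm_algebraMap']
  rw [dist_eq_norm, PadicInt.norm_def] at hm
  exact_mod_cast hm.le

variable {F : Type*} [Field F] [NumberField F]

/-- An element of a number field which is integral at all places above `p` becomes an algebraic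
integer after multiplication by an integer prime to `p`: the coefficients of its minimal polynomial
are symmetric functions of its conjugates, so they have no `p` in the denominator. -/
theorem exists_isIntegral_intCast_mul {a : F} (ha : ∀ j : F →+* PadicAlgCl p, ‖j a‖ ≤ 1) :
    ∃ m : ℤ, ¬ (p : ℤ) ∣ m ∧ IsIntegral ℤ ((m : F) * a) := by
  set f := minpoly ℚ a with hf
  have hmonic : f.Monic := minpoly.monic (Algebra.IsIntegral.isIntegral a)
  have hroot : ∀ y ∈ (f.map (algebraMap ℚ (PadicAlgCl p))).roots, ‖y‖ ≤ 1 := by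
    intro y hy
    have h : y ∈ f.rootSet (PadicAlgCl p) := by
      classical
      rw [Polynomial.rootSet_def, Finset.mem_coe, Multiset.mem_toFinset]
      exact hy
    rw [hf, ← Algebra.IsAlgebraic.range_eval_eq_rootSet_minpoly] at h
    obtain ⟨j, rfl⟩ := h
    exact ha j
  have hcoeff : ∀ i, ¬ (p : ℤ) ∣ (f.coeff i).den := by
    intro i
    have hlift : f.map (algebraMap ℚ (PadicAlgCl p)) ∈
        Polynomial.lifts (normPlace p).integers.subtype := by
      rw [(IsAlgClosed.splits _).eq_prod_roots_of_monic (hmonic.map _)]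
      refine Submonoid.multiset_prod_mem _ _ fun g hg => ?_
      obtain ⟨y, hy, rfl⟩ := Multiset.mem_map.1 hg
      exact ⟨Polynomial.X - Polynomial.C ⟨y, hroot y hy⟩, by simp⟩
    obtain ⟨c, hc⟩ := (Polynomial.lifts_iff_coeff_lifts _).1 hlift i
    have h1 : (normPlace p).1 (algebraMap ℚ (PadicAlgCl p) (f.coeff i)) ≤ 1 := by
      rw [← Polynomial.coeff_map, ← hc]
      exact c.2
    rw [(normPlace p).2.2] at h1
    have h2 : padicNorm p (f.coeff i) ≤ 1 := by exact_mod_cast h1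
    intro hdvd
    have hlt : padicNorm p ((f.coeff i).num : ℚ) < 1 := by
      rw [← Rat.mul_den_eq_num, padicNorm.mul]
      refine (mul_le_of_le_one_left (padicNorm.nonneg _) h2).trans_lt ?_
      exact_mod_cast (padicNorm.int_lt_one_iff _).2 hdvd
    have hnum := (padicNorm.int_lt_one_iff _).1 hlt
    exact (Nat.prime_iff_prime_int.1 (Fact.out : p.Prime)).not_isUnit
      ((f.coeff i).isCoprime_num_den.isUnit_of_dvd' hnum hdvd)
  set m : ℤ := ∏ i ∈ Finset.range f.natDegree, ((f.coeff i).den : ℤ) with hm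
  refine ⟨m, fun h => ?_, ?_⟩
  · obtain ⟨i, -, hi⟩ := (Nat.prime_iff_prime_int.1 (Fact.out : p.Prime)).exists_mem_finset_dvd h
    exact hcoeff i hi
  -- the monic polynomial with root `m * a` obtained from `f` has integer coefficients
  · have hlift : f.scaleRoots (m : ℚ) ∈ Polynomial.lifts (Int.castRingHom ℚ) := by
      rw [Polynomial.lifts_iff_coeff_lifts]
      intro i
      rw [Polynomial.coeff_scaleRoots]
      rcases lt_trichotomy i f.natDegree with hi | rfl | hi
      · obtain ⟨d, hd⟩ : ((f.coeff i).den : ℤ) ∣ m :=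
          Finset.dvd_prod_of_mem _ (Finset.mem_range.2 hi)
        obtain ⟨k, hk⟩ := Nat.exists_eq_add_of_lt hi
        refine ⟨(f.coeff i).num * d * m ^ k, ?_⟩
        have hk' : f.natDegree - i = k + 1 := by omega
        have hden : f.coeff i * (f.coeff i).den = (f.coeff i).num := Rat.mul_den_eq_num _
        have hmq : (m : ℚ) = (f.coeff i).den * d := by exact_mod_cast hd
        rw [hk', pow_succ', eq_intCast]
        push_cast
        rw [← hden]
        nth_rewrite 2 [hmq]
        ring
      · exact ⟨1, by simp [hmonic]⟩
      · exact ⟨0, by simp [Polynomial.coeff_eq_zero_of_natDegree_lt hi]⟩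
    obtain ⟨g, hg, -, hgm⟩ := Polynomial.lifts_and_natDegree_eq_and_monic hlift
      ((Polynomial.monic_scaleRoots_iff _).2 hmonic)
    refine ⟨g, hgm, ?_⟩
    have h := Polynomial.scaleRoots_aeval_eq_zero (r := (m : ℚ)) (minpoly.aeval ℚ a)
    rw [← hf, ← hg, Polynomial.aeval_def, Polynomial.eval₂_map] at h
    rw [← h, map_intCast]
    congr 1
    exact Subsingleton.elim _ _

end Padic

/-! ### The largest subfield in which `p` splits completely -/

section SplitSubfield

variable (p : ℕ) [Fact p.Prime] (F : Type*) [Field F] [NumberField F]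

open NumberField

/-- The subfield of the elements of `F` all of whose `p`-adic conjugates lie in `ℚ_p`. -/
noncomputable def splitSubfield : IntermediateField ℚ F :=
  (⨅ j : F →+* PadicAlgCl p,
    (algebraMap ℚ_[p] (PadicAlgCl p)).fieldRange.comap j).toIntermediateField fun q => by
      simp only [Subfield.mem_iInf, Subfield.mem_comap]
      exact fun j => ⟨q, by simp⟩

variable {p F}

theorem mem_splitSubfield {a : F} : a ∈ splitSubfield p F ↔
    ∀ j : F →+* PadicAlgCl p, j a ∈ (algebraMap ℚ_[p] (PadicAlgCl p)).fieldRange := by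
  change a ∈ (⨅ j : F →+* PadicAlgCl p,
    (algebraMap ℚ_[p] (PadicAlgCl p)).fieldRange.comap j) ↔ _
  simp only [Subfield.mem_iInf, Subfield.mem_comap]

/-- Every subfield in which `p` splits completely, Galois or not, embeds into `ℚ_p` under all
embeddings of `F`. -/
theorem le_splitSubfield {E : IntermediateField ℚ F} (hE : SplitsCompletely p E) :
    E ≤ splitSubfield p F := by
  intro x hx
  rw [mem_splitSubfield]
  intro j
  obtain ⟨y, d, hd, hyd⟩ := IsFractionRing.div_surjective (A := 𝓞 E) (⟨x, hx⟩ : E)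
  have key : ∀ z : 𝓞 E, j (algebraMap (𝓞 E) E z : E) ∈
      (algebraMap ℚ_[p] (PadicAlgCl p)).fieldRange := fun z =>
    mem_fieldRange_of_isLimitOfInt (((normPlace p).isLimitOfInt_comap_iff
      (j.comp (algebraMap E F)) _).1 (hE.isLimitOfInt _ z))
  have h : x = (algebraMap (𝓞 E) E y : E) / (algebraMap (𝓞 E) E d : E) := by
    have := congrArg (Subtype.val : E → F) hyd
    simpa using this.symm
  rw [h, map_div₀]
  exact div_mem (key y) (key d)

theorem isGalois_splitSubfield [IsGalois ℚ F] : IsGalois ℚ (splitSubfield p F) := by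
  have : Normal ℚ (splitSubfield p F) := by
    have e : (DivisionRing.toRatAlgebra : Algebra ℚ (splitSubfield p F)) =
        (splitSubfield p F).algebra' := Subsingleton.elim _ _
    rw [e, IntermediateField.normal_iff_forall_map_le]
    rintro σ _ ⟨x, hx, rfl⟩
    exact mem_splitSubfield.2 fun j => mem_splitSubfield.1 hx (j.comp σ)
  constructor

theorem splitsCompletely_splitSubfield [IsGalois ℚ F] :
    SplitsCompletely p (splitSubfield p F) := by
  let j : F →+* PadicAlgCl p := (IsAlgClosed.lift : F →ₐ[ℚ] PadicAlgCl p)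
  have hgal := isGalois_splitSubfield (p := p) (F := F)
  refine splitsCompletely_of_isLimitOfInt
    ((normPlace p).comap (j.comp (algebraMap (splitSubfield p F) F))) fun x => ?_
  rw [Place.isLimitOfInt_comap_iff]
  refine isLimitOfInt_of_mem_fieldRange
    (mem_splitSubfield.1 (algebraMap (𝓞 (splitSubfield p F)) (splitSubfield p F) x).2 j) ?_
  exact ((normPlace p).comap (j.comp (algebraMap (splitSubfield p F) F))).le_one_of_isIntegral
    x.isIntegral_coe

/-- Every embedding of `F` into the algebraic closure of `ℚ_p` is induced by a place of
`F ⊗ ℚᵃᵇ`. -/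
theorem isLimitOfInt_of_mem_limitOfIntSubring {a : F} (ha : a ∈ limitOfIntSubring F p)
    (j : F →+* PadicAlgCl p) : (normPlace p).IsLimitOfInt (j a) := by
  let g : F ⊗[ℚ] Qab →ₐ[ℚ] PadicAlgCl p := Algebra.TensorProduct.lift
    j.toRatAlgHom (IsAlgClosed.lift : Qab →ₐ[ℚ] PadicAlgCl p) fun _ _ => Commute.all _ _
  have h := (mem_limitOfIntSubring p).1 ha ((normPlace p).comap g.toRingHom)
  rw [Place.isLimitOfInt_comap_iff] at h
  have hg : g (a ⊗ₜ 1) = j a := by simp [g]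
  rwa [← hg]

theorem coe_mem_limitOfIntSubring {E : IntermediateField ℚ F} (hE : SplitsCompletely p E)
    (x : 𝓞 E) : ((algebraMap (𝓞 E) E x : E) : F) ∈ limitOfIntSubring F p := by
  rw [mem_limitOfIntSubring]
  intro v
  exact (v.isLimitOfInt_comap_iff ((Algebra.TensorProduct.includeLeftRingHom :
    F →+* F ⊗[ℚ] Qab).comp (algebraMap E F)) _).1 (hE.isLimitOfInt _ x)

theorem mem_splitSubfield_of_mem_limitOfIntSubring {a : F} (ha : a ∈ limitOfIntSubring F p) :
    a ∈ splitSubfield p F :=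
  mem_splitSubfield.2 fun j =>
    mem_fieldRange_of_isLimitOfInt (isLimitOfInt_of_mem_limitOfIntSubring ha j)

theorem mem_limitOfIntSubring_of_intCast_mul {m : ℤ} (hm : ¬ (p : ℤ) ∣ m) {a : F}
    (h : (m : F) * a ∈ limitOfIntSubring F p) : a ∈ limitOfIntSubring F p := by
  rw [mem_limitOfIntSubring] at h ⊢
  intro v
  refine Place.isLimitOfInt_of_intCast_mul hm ?_
  have := (v.isLimitOfInt_comap_iff (Algebra.TensorProduct.includeLeftRingHom :
    F →+* F ⊗[ℚ] Qab) (m * a)).2 (h v)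
  rw [Place.isLimitOfInt_comap_iff, map_mul, map_intCast] at this
  exact this

theorem ne_zero_of_not_dvd {m : ℤ} (hm : ¬ (p : ℤ) ∣ m) : (m : F) ≠ 0 := by
  rintro h
  obtain rfl : m = 0 := by exact_mod_cast h
  exact hm (dvd_zero _)

variable (p F) in
/-- The limits of integers at all places above `p` form the localization at `p` of the ring of
integers of the largest subfield in which `p` splits completely. -/
theorem nonempty_limitOfIntSubring_equiv [IsGalois ℚ F] :
    Nonempty (limitOfIntSubring F p ≃+*
      Localization (primeToP p (𝓞 (splitSubfield p F)))) := by
  let f : 𝓞 (splitSubfield p F) →+* limitOfIntSubring F p :=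
    ((algebraMap (splitSubfield p F) F).comp
      (algebraMap (𝓞 (splitSubfield p F)) (splitSubfield p F))).codRestrict _
      (coe_mem_limitOfIntSubring splitsCompletely_splitSubfield)
  have hf : ∀ x, ((f x : limitOfIntSubring F p) : F) =
      (algebraMap (𝓞 (splitSubfield p F)) (splitSubfield p F) x : splitSubfield p F) :=
    fun _ => rfl
  have hinj : Function.Injective f := by
    intro x y hxy
    have := congrArg (Subtype.val : limitOfIntSubring F p → F) hxy
    rw [hf, hf] at this
    exact RingOfIntegers.coe_injective (Subtype.ext this)
  let : Algebra (𝓞 (splitSubfield p F)) (limitOfIntSubring F p) := f.toAlgebra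
  have : IsLocalization (primeToP p (𝓞 (splitSubfield p F))) (limitOfIntSubring F p) := by
    rw [isLocalization_iff]
    refine ⟨?_, ?_, fun {x y} hxy => ⟨1, by rw [hinj hxy]⟩⟩
    · rintro ⟨_, m, hm, rfl⟩
      have h0 := ne_zero_of_not_dvd (F := F) hm
      refine IsUnit.of_mul_eq_one ⟨(m : F)⁻¹, mem_limitOfIntSubring_of_intCast_mul hm ?_⟩ ?_
      · rw [mul_inv_cancel₀ h0]
        exact one_mem _
      · ext
        change ((f (m : 𝓞 (splitSubfield p F)) : limitOfIntSubring F p) : F) * (m : F)⁻¹ = 1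
        rw [map_intCast, Subring.coe_intCast, mul_inv_cancel₀ h0]
    · rintro ⟨a, ha⟩
      obtain ⟨m, hm, hint⟩ := exists_isIntegral_intCast_mul (p := p) (a := a) fun j =>
        (isLimitOfInt_of_mem_limitOfIntSubring ha j).le_one
      have hmem : (m : F) * a ∈ splitSubfield p F :=
        mul_mem (intCast_mem _ m) (mem_splitSubfield_of_mem_limitOfIntSubring ha)
      have hint' : IsIntegral ℤ (⟨(m : F) * a, hmem⟩ : splitSubfield p F) :=
        (isIntegral_algHom_iff ((splitSubfield p F).val.restrictScalars ℤ)
          Subtype.val_injective).1 hint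
      refine ⟨⟨⟨_, hint'⟩, ⟨(m : 𝓞 (splitSubfield p F)), m, hm, rfl⟩⟩, ?_⟩
      ext
      change a * ((f (m : 𝓞 (splitSubfield p F)) : limitOfIntSubring F p) : F) = (m : F) * a
      rw [map_intCast, Subring.coe_intCast, mul_comm]
  exact ⟨(IsLocalization.algEquiv (primeToP p (𝓞 (splitSubfield p F))) (limitOfIntSubring F p)
    (Localization (primeToP p (𝓞 (splitSubfield p F))))).toRingEquiv⟩

end SplitSubfield

end OverconvergentWitt

theorem mainTheorem4 (p : ℕ) [Fact p.Prime] (F : Type*) [Field F] [NumberField F] [IsGalois ℚ F] :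
    ∃ F₀ : IntermediateField ℚ F,
      IsGreatest {E : IntermediateField ℚ F |
        IsGalois ℚ E ∧ OverconvergentWitt.SplitsCompletely p E} F₀ ∧
      Nonempty (OverconvergentWitt.invariants p F ≃+*
        Localization (OverconvergentWitt.primeToP p (NumberField.RingOfIntegers F₀))) := by
  obtain ⟨e⟩ := OverconvergentWitt.nonempty_invariants_equiv F p
  obtain ⟨e'⟩ := OverconvergentWitt.nonempty_limitOfIntSubring_equiv p F
  exact ⟨OverconvergentWitt.splitSubfield p F,
    ⟨⟨OverconvergentWitt.isGalois_splitSubfield, OverconvergentWitt.splitsCompletely_splitSubfield⟩,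
      fun _ hE => OverconvergentWitt.le_splitSubfield hE.2⟩, ⟨e.trans e'⟩⟩
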